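/- Let $a>2$ and $p_0\in[1/2,1]$, and let $y_1,y_2,\dots$ be i.i.d. with density $p_{\mathrm{true}}=p_0\,\mathrm{Cauchy}(a,1)+(1-p_0)\,\mathrm{Cauchy}(-a,1)$. Fit the model $y_i\sim\mathrm{Cauchy}(\mu,1)$ i.i.d., with density $p(y|\mu)=\frac{1}{\pi(1+(y-\mu)^2)}$, under a prior probability distribution on $\mathbb{R}$ with full support, and let $p(\mu|y_1,\dots,y_n)$ be the exact posterior. Put $$\mathrm{elpd}_n=\int_{\mathbb{R}}p_{\mathrm{true}}(\tilde y)\,\log\Big(\int_{\mathbb{R}}p(\tilde y|\mu)\,p(\mu|y_1,\dots,y_n)\,d\mu\Big)\,d\tilde y ,$$ $$h(\mu)=-\int_{\mathbb{R}}\log\big(1+(y-\mu)^2\big)\Big(\frac{1-p_0}{(a+y)^2+1}+\frac{p_0}{(y-a)^2+1}\Big)\,dy .$$ There is a function $\gamma=\gamma(p_0,a)$, depending only on $p_0$ and $a$, such that $\gamma$ is the unique global maximizer of $h$ if $p_0>1/2$, and $\gamma=\sqrt{a^2-4}$ if $p_0=1/2$, and such that the following holds. The posterior is a probability measure and the integral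 defining $\mathrm{elpd}_n$ converges absolutely, for all data and all $n$. With $$L(p_0,a)=-\Big(p_0\log\big(\pi(4+(\gamma-a)^2)\big)+(1-p_0)\log\big(\pi(4+(\gamma+a)^2)\big)\Big):$$ (i) if $p_0>1/2$, then almost surely, as $n\to\infty$, the posterior converges weakly to the point mass $\delta(\gamma)$ and $\mathrm{elpd}_n\to L(p_0,a)$; (ii) if $p_0=1/2$ and the prior is symmetric about $0$, then $\mathrm{elpd}_n\to L(p_0,a)$ in probability as $n\to\infty$. Moreover, for every fixed $p_0\in[1/2,1]$, as $a\to\infty$, $$L(p_0,a)=-(1-p_0)\log(1+a^2)-\log 4\pi+o(1).$$ -/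

import Mathlib

open MeasureTheory ProbabilityTheory Filter Topology

namespace CauchyMixture

/-- Density of the data generating process: the mixture of `Cauchy(a, 1)` (weight `p₀`) and
`Cauchy(-a, 1)` (weight `1 - p₀`). -/
noncomputable def trueDensity (a p₀ y : ℝ) : ℝ :=
  p₀ * cauchyPDFReal a 1 y + (1 - p₀) * cauchyPDFReal (-a) 1 y

/-- Law of one observation of the data generating process. -/
noncomputable def trueLaw (a p₀ : ℝ) : Measure ℝ :=
  volume.withDensity fun y => ENNReal.ofReal (trueDensity a p₀ y)

/-- Likelihood of the location `μ` in the model `y₀, …, y₍ₙ₋₁₎ ∼ Cauchy(μ, 1)` iid. -/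
noncomputable def likelihood (y : ℕ → ℝ) (n : ℕ) (μ : ℝ) : ENNReal :=
  ∏ i ∈ Finset.range n, cauchyPDF μ 1 (y i)

/-- The exact Bayesian posterior of `μ` given the first `n` observations: the prior reweighted by
the likelihood and normalized. -/
noncomputable def posterior (prior : Measure ℝ) (y : ℕ → ℝ) (n : ℕ) : Measure ℝ :=
  (∫⁻ μ, likelihood y n μ ∂prior)⁻¹ • prior.withDensity (likelihood y n)

/-- Density at `t` of the predictive distribution when `μ` has distribution `ν`. -/
noncomputable def predictiveDensity (ν : Measure ℝ) (t : ℝ) : ℝ :=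
  ∫ μ, cauchyPDFReal μ 1 t ∂ν

/-- Expected log predictive density of `ν` under the data generating process. -/
noncomputable def elpd (a p₀ : ℝ) (ν : Measure ℝ) : ℝ :=
  ∫ t, trueDensity a p₀ t * Real.log (predictiveDensity ν t)

/-- Up to a positive factor and an additive constant, the expected log likelihood of `μ` for one
observation of the data generating process. -/
noncomputable def h (a p₀ μ : ℝ) : ℝ :=
  -∫ y, Real.log (1 + (y - μ) ^ 2) * ((1 - p₀) / ((a + y) ^ 2 + 1) + p₀ / ((y - a) ^ 2 + 1))

/-- The limiting value of the expected log predictive density, at a limit point `g`. -/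
noncomputable def elpdLimit (a p₀ g : ℝ) : ℝ :=
  -(p₀ * Real.log (Real.pi * (4 + (g - a) ^ 2))
    + (1 - p₀) * Real.log (Real.pi * (4 + (g + a) ^ 2)))

end CauchyMixture

/-! The computation rests on one closed formula: if `Y` is Cauchy(`m`, 1), the expectation of `log
(1 + (Y - μ)²)` is `log (4 + (μ - m)²)` (`integral_cauchyPDFReal_mul_log`). The substitution `y =
tan φ` turns it into circle averages of `log ‖u - z‖` with `‖z‖ ≤ 1`, which vanish. So `h` is `-π`
times the explicit function `risk`, and `elpdLimit` is minus `risk` minus `log π`. A critical point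
of `risk` solves a cubic. For `p > 1/2` the minimizer is unique and positive; for `p = 1/2` the
minimizers are `±√(a² - 4)`. For large `a` the minimizer stays within distance 4 of `a`, so `risk`
may be evaluated at `a` itself.

Posterior consistency is Wald's argument. The strong law at rational locations, the Lipschitz bound
and a tail bound make the average negative log likelihood exceed the minimal risk by a fixed margin,
uniformly off any neighbourhood of the minimizers (`IsTypical.eventually_forall_le`). There the
posterior mass is exponentially small. Since `elpd` is continuous along measures concentrating at a
point (`tendsto_elpd_of_concentrates`), this settles `p > 1/2`.

For `p = 1/2` the two modes compete. The log likelihood ratio of `g` and `-g` is a centered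
nondegenerate iid sum, so by the central limit theorem it exceeds `κ √n` in size with high
probability. Over a ball of radius `δ` around `g` it oscillates by `O(δ √n)` on average, so for
small `δ` its sign is constant on the ball. With a symmetric prior one of the two mirror balls then
loses its mass (`exists_pos_eventually_measure_no_mode_le`). The random winner does not matter, as
`elpdLimit` agrees at `g` and `-g`. -/

namespace CauchyMixture

/-! ### Cross entropy of Cauchy laws through averages over the unit circle -/

/-- The substitution `y = tan φ`: the logarithm splits into logarithms of distances from a
point of the unit circle. -/
lemma log_one_add_tan_sub_sq (s : ℝ) {φ : ℝ} (hφ : φ ∈ Set.Ioo (-(Real.pi / 2)) (Real.pi / 2)) :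
    Real.log (1 + (Real.tan φ - s) ^ 2) =
      Real.log (4 + s ^ 2) + 2 * Real.log ‖circleMap 0 1 (2 * φ) - s * Complex.I /
        (2 - s * Complex.I)‖ - 2 * Real.log ‖circleMap 0 1 (2 * φ) - (-1)‖ := by
  have hC : 0 < Real.cos φ := Real.cos_pos_of_mem_Ioo hφ
  have hz : circleMap 0 1 (2 * φ) = ⟨Real.cos (2 * φ), Real.sin (2 * φ)⟩ := by
    rw [circleMap_zero]
    apply Complex.ext
    · simp [Complex.exp_ofReal_mul_I_re, -Complex.ofReal_ofNat, -Complex.ofReal_mul]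
    · simp [Complex.exp_ofReal_mul_I_im, -Complex.ofReal_ofNat, -Complex.ofReal_mul]
  have hw : (2 - s * Complex.I : ℂ) ≠ 0 := by
    intro h
    simpa using congrArg Complex.re h
  have hS := Real.sin_sq_add_cos_sq φ
  have hnw : ‖(2 - s * Complex.I : ℂ)‖ ^ 2 = 4 + s ^ 2 := by
    rw [← Complex.normSq_eq_norm_sq, Complex.normSq_apply]
    simp
    ring
  have h1 : ‖circleMap 0 1 (2 * φ) - (-1)‖ ^ 2 = 4 * Real.cos φ ^ 2 := by
    rw [← Complex.normSq_eq_norm_sq, Complex.normSq_apply, hz]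
    simp only [Complex.sub_re, Complex.neg_re, Complex.one_re, Complex.sub_im, Complex.neg_im,
      Complex.one_im, Real.cos_two_mul, Real.sin_two_mul]
    linear_combination 4 * Real.cos φ ^ 2 * hS
  -- With `u = exp (2iφ)`, one has `tan φ - s - i = -i ((2 - si) u - si) / (u + 1)`, and `1 + (tan φ
  -- - s)²` is the squared modulus of the left side.
  have h2 : ‖circleMap 0 1 (2 * φ) - s * Complex.I / (2 - s * Complex.I)‖ ^ 2 * (4 + s ^ 2) =
      4 * Real.cos φ ^ 2 * (1 + (Real.tan φ - s) ^ 2) := by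
    rw [← hnw, ← mul_pow, ← norm_mul, sub_mul, div_mul_cancel₀ _ hw,
      ← Complex.normSq_eq_norm_sq, Complex.normSq_apply, hz]
    simp only [Complex.sub_re, Complex.mul_re, Complex.re_ofNat, Complex.sub_im, Complex.mul_im,
      Complex.im_ofNat, Complex.ofReal_re, Complex.ofReal_im, Complex.I_re, Complex.I_im,
      Real.cos_two_mul, Real.sin_two_mul, Real.tan_eq_sin_div_cos]
    field_simp
    have hS' : Real.sin φ ^ 2 = 1 - Real.cos φ ^ 2 := by linarith
    ring_nf
    simp only [hS']
    ring
  have hpos : 0 < 1 + (Real.tan φ - s) ^ 2 := by positivity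
  have hn1 : ‖circleMap 0 1 (2 * φ) - (-1)‖ ≠ 0 := by
    intro h; rw [h] at h1; nlinarith
  have hn2 : ‖circleMap 0 1 (2 * φ) - s * Complex.I / (2 - s * Complex.I)‖ ≠ 0 := by
    intro h; rw [h] at h2
    have : 0 < 4 * Real.cos φ ^ 2 * (1 + (Real.tan φ - s) ^ 2) := by positivity
    rw [← h2] at this; norm_num at this
  have h3 := congrArg Real.log h2
  rw [← h1, Real.log_mul (by positivity) (by positivity), Real.log_mul (by positivity) hpos.ne',
    Real.log_pow, Real.log_pow] at h3
  push_cast at h3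
  linarith

lemma circleIntegrable_log_norm_combination (A B c : ℝ) (z w : ℂ) :
    CircleIntegrable (fun u => c + A * Real.log ‖u - z‖ - B * Real.log ‖u - w‖) 0 1 := by
  have h1 : CircleIntegrable (fun _ : ℂ => c) 0 1 := circleIntegrable_const c 0 1
  have h2 : CircleIntegrable (fun u : ℂ => A * Real.log ‖u - z‖) 0 1 := by
    simpa [CircleIntegrable] using
      IntervalIntegrable.const_mul (circleIntegrable_log_norm_sub_const (a := z) (c := 0) 1) A
  have h3 : CircleIntegrable (fun u : ℂ => B * Real.log ‖u - w‖) 0 1 := by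
    simpa [CircleIntegrable] using
      IntervalIntegrable.const_mul (circleIntegrable_log_norm_sub_const (a := w) (c := 0) 1) B
  exact (h1.add h2).sub h3

/-- By Jensen's formula the average of `log ‖u - z‖` over the unit circle is `log⁺ ‖z‖`, which is
zero on the closed disc, boundary included. The point `-1` coming from `u + 1` is such a boundary
point. -/
lemma circleAverage_log_norm_combination (A B c : ℝ) {z w : ℂ} (hz : ‖z‖ ≤ 1) (hw : ‖w‖ ≤ 1) :
    Real.circleAverage (fun u => c + A * Real.log ‖u - z‖ - B * Real.log ‖u - w‖) 0 1 = c := by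
  have h1 : CircleIntegrable (fun _ : ℂ => c) 0 1 := circleIntegrable_const c 0 1
  have h2 : CircleIntegrable (fun u : ℂ => A * Real.log ‖u - z‖) 0 1 := by
    simpa [CircleIntegrable] using
      IntervalIntegrable.const_mul (circleIntegrable_log_norm_sub_const (a := z) (c := 0) 1) A
  have h3 : CircleIntegrable (fun u : ℂ => B * Real.log ‖u - w‖) 0 1 := by
    simpa [CircleIntegrable] using
      IntervalIntegrable.const_mul (circleIntegrable_log_norm_sub_const (a := w) (c := 0) 1) B
  have e (A : ℝ) {z : ℂ} (hz : ‖z‖ ≤ 1) :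
      Real.circleAverage (fun u : ℂ => A * Real.log ‖u - z‖) 0 1 = 0 := by
    have := Real.circleAverage_fun_smul (a := A) (f := fun u : ℂ => Real.log ‖u - z‖) (c := 0)
      (R := 1)
    simp only [smul_eq_mul] at this
    rw [this, circleAverage_log_norm_sub_const_eq_posLog, Real.posLog_eq_zero_iff _ |>.2, mul_zero]
    simpa using hz
  have h12 : CircleIntegrable (fun u : ℂ => c + A * Real.log ‖u - z‖) 0 1 := h1.add h2
  rw [Real.circleAverage_fun_sub h12 h3, Real.circleAverage_fun_add h1 h2, e A hz, e B hw,
    Real.circleAverage_const]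
  simp

/-- The integral over an angle `2 φ` running once around the circle is a circle average. -/
lemma integral_circleMap_two_mul (f : ℂ → ℝ) :
    ∫ φ in Set.Ioo (-(Real.pi / 2)) (Real.pi / 2), f (circleMap 0 1 (2 * φ)) =
      Real.pi * Real.circleAverage f 0 1 := by
  have hpi := Real.pi_pos
  rw [← integral_Ioc_eq_integral_Ioo, ← intervalIntegral.integral_of_le (by linarith),
    intervalIntegral.integral_comp_mul_left (fun θ => f (circleMap 0 1 θ)) two_ne_zero,
    Real.circleAverage_def]
  have hper : Function.Periodic (fun θ => f (circleMap 0 1 θ)) (2 * Real.pi) :=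
    (periodic_circleMap 0 1).comp f
  have := hper.intervalIntegral_add_eq (-Real.pi) 0
  rw [show 2 * -(Real.pi / 2) = -Real.pi by ring, show 2 * (Real.pi / 2) = -Real.pi + 2 * Real.pi
    by ring, this, zero_add]
  simp only [smul_eq_mul]
  field_simp

lemma integrableOn_circleMap_two_mul {f : ℂ → ℝ} (hf : CircleIntegrable f 0 1) :
    IntegrableOn (fun φ => f (circleMap 0 1 (2 * φ)))
      (Set.Ioo (-(Real.pi / 2)) (Real.pi / 2)) := by
  have hpi := Real.pi_pos
  have hper : Function.Periodic (fun θ => f (circleMap 0 1 θ)) (2 * Real.pi) :=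
    (periodic_circleMap 0 1).comp f
  have h1 : IntervalIntegrable (fun θ => f (circleMap 0 1 θ)) volume (-Real.pi) Real.pi :=
    hper.intervalIntegrable₀ (by positivity) hf _ _
  have h2 := h1.comp_mul_left (c := 2)
  rw [show -Real.pi / 2 = -(Real.pi / 2) by ring,
    intervalIntegrable_iff_integrableOn_Ioo_of_le (by linarith)] at h2
  exact h2

lemma cauchyPDFReal_one (m y : ℝ) : cauchyPDFReal m 1 y = (Real.pi * (1 + (y - m) ^ 2))⁻¹ := by
  rw [cauchyPDFReal_def, mul_inv]
  simp [add_comm]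

lemma log_integrand_comp_arctan (s y : ℝ) :
    |1 / (1 + y ^ 2)| • Real.log (1 + (Real.tan (Real.arctan y) - s) ^ 2) =
      Real.pi * (cauchyPDFReal 0 1 y * Real.log (1 + (y - s) ^ 2)) := by
  rw [Real.tan_arctan, cauchyPDFReal_one, abs_of_pos (by positivity), smul_eq_mul]
  have := Real.pi_pos
  field_simp
  simp [mul_comm]

lemma norm_mul_I_div_le_one (s : ℝ) : ‖(s * Complex.I / (2 - s * Complex.I) : ℂ)‖ ≤ 1 := by
  have hw : (2 - s * Complex.I : ℂ) ≠ 0 := by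
    intro h
    simpa using congrArg Complex.re h
  rw [norm_div, div_le_one (norm_pos_iff.2 hw)]
  refine le_of_sq_le_sq ?_ (norm_nonneg _)
  rw [← Complex.normSq_eq_norm_sq, ← Complex.normSq_eq_norm_sq, Complex.normSq_apply,
    Complex.normSq_apply]
  simp

lemma image_arctan_univ :
    Real.arctan '' Set.univ = Set.Ioo (-(Real.pi / 2)) (Real.pi / 2) := by
  rw [Set.image_univ, Real.range_arctan]

/-- Under `y = tan φ` the standard Cauchy law becomes the uniform law of the angle, and the
integrand becomes logarithms of distances on the circle, which are integrable. -/
lemma integrable_standardCauchy_mul_log (s : ℝ) :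
    Integrable (fun y => cauchyPDFReal 0 1 y * Real.log (1 + (y - s) ^ 2)) := by
  have h1 : IntegrableOn (fun φ => Real.log (1 + (Real.tan φ - s) ^ 2))
      (Set.Ioo (-(Real.pi / 2)) (Real.pi / 2)) :=
    (integrableOn_circleMap_two_mul (circleIntegrable_log_norm_combination 2 2
      (Real.log (4 + s ^ 2)) (s * Complex.I / (2 - s * Complex.I)) (-1))).congr_fun
      (fun φ hφ => (log_one_add_tan_sub_sq s hφ).symm) measurableSet_Ioo
  rw [← image_arctan_univ, integrableOn_image_iff_integrableOn_abs_deriv_smul MeasurableSet.univ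
    (fun x _ => (Real.hasDerivAt_arctan x).hasDerivWithinAt) Real.arctan_injective.injOn] at h1
  simp only [log_integrand_comp_arctan, integrableOn_univ] at h1
  simpa [← mul_assoc, Real.pi_pos.ne'] using h1.const_mul Real.pi⁻¹

lemma integral_standardCauchy_mul_log (s : ℝ) :
    ∫ y, cauchyPDFReal 0 1 y * Real.log (1 + (y - s) ^ 2) = Real.log (4 + s ^ 2) := by
  have h1 : ∫ φ in Set.Ioo (-(Real.pi / 2)) (Real.pi / 2), Real.log (1 + (Real.tan φ - s) ^ 2) =
      Real.pi * Real.log (4 + s ^ 2) := by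
    rw [setIntegral_congr_fun measurableSet_Ioo fun φ hφ => log_one_add_tan_sub_sq s hφ,
      integral_circleMap_two_mul (fun u => Real.log (4 + s ^ 2) + 2 * Real.log ‖u - s * Complex.I /
        (2 - s * Complex.I)‖ - 2 * Real.log ‖u - (-1)‖),
      circleAverage_log_norm_combination 2 2 _ (norm_mul_I_div_le_one s) (by simp)]
  rw [← image_arctan_univ, integral_image_eq_integral_abs_deriv_smul MeasurableSet.univ
    (fun x _ => (Real.hasDerivAt_arctan x).hasDerivWithinAt) Real.arctan_injective.injOn] at h1
  simp only [log_integrand_comp_arctan, setIntegral_univ] at h1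
  rw [integral_const_mul] at h1
  exact mul_left_cancel₀ Real.pi_pos.ne' h1

lemma integrable_cauchyPDFReal_mul_log (m μ : ℝ) :
    Integrable (fun y => cauchyPDFReal m 1 y * Real.log (1 + (y - μ) ^ 2)) := by
  refine ((integrable_standardCauchy_mul_log (μ - m)).comp_sub_right m).congr
    (ae_of_all _ fun y => ?_)
  simp only [cauchyPDFReal_one]
  ring_nf

/-- The cross entropy of two Cauchy distributions of scale one, up to `log π`. -/
lemma integral_cauchyPDFReal_mul_log (m μ : ℝ) :
    ∫ y, cauchyPDFReal m 1 y * Real.log (1 + (y - μ) ^ 2) = Real.log (4 + (μ - m) ^ 2) := by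
  rw [← integral_standardCauchy_mul_log, ← integral_sub_right_eq_self
    (fun y => cauchyPDFReal 0 1 y * Real.log (1 + (y - (μ - m)) ^ 2)) m]
  congr 1 with y
  simp only [cauchyPDFReal_one]
  ring_nf

/-! ### The risk function and the data generating law -/

/-- Expected value of `log (1 + (Y - μ) ^ 2)` under the data generating process. -/
noncomputable def risk (a p μ : ℝ) : ℝ :=
  p * Real.log (4 + (μ - a) ^ 2) + (1 - p) * Real.log (4 + (μ + a) ^ 2)

lemma elpdLimit_eq (a p g : ℝ) : elpdLimit a p g = -Real.log Real.pi - risk a p g := by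
  rw [elpdLimit, risk, Real.log_mul Real.pi_pos.ne' (by positivity),
    Real.log_mul Real.pi_pos.ne' (by positivity)]
  ring

lemma trueDensity_mul_log_eq (a p μ y : ℝ) :
    trueDensity a p y * Real.log (1 + (y - μ) ^ 2) =
      p * (cauchyPDFReal a 1 y * Real.log (1 + (y - μ) ^ 2)) +
        (1 - p) * (cauchyPDFReal (-a) 1 y * Real.log (1 + (y - μ) ^ 2)) := by
  rw [trueDensity]
  ring

lemma integrable_trueDensity_mul_log (a p μ : ℝ) :
    Integrable (fun y => trueDensity a p y * Real.log (1 + (y - μ) ^ 2)) := by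
  simp only [trueDensity_mul_log_eq]
  exact ((integrable_cauchyPDFReal_mul_log _ _).const_mul _).add
    ((integrable_cauchyPDFReal_mul_log _ _).const_mul _)

lemma integral_trueDensity_mul_log (a p μ : ℝ) :
    ∫ y, trueDensity a p y * Real.log (1 + (y - μ) ^ 2) = risk a p μ := by
  simp only [trueDensity_mul_log_eq]
  rw [integral_add ((integrable_cauchyPDFReal_mul_log _ _).const_mul _)
    ((integrable_cauchyPDFReal_mul_log _ _).const_mul _), integral_const_mul, integral_const_mul,
    integral_cauchyPDFReal_mul_log, integral_cauchyPDFReal_mul_log, sub_neg_eq_add, risk]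

lemma h_eq (a p μ : ℝ) : h a p μ = -(Real.pi * risk a p μ) := by
  rw [h, ← integral_trueDensity_mul_log, ← integral_const_mul]
  congr 2 with y
  rw [trueDensity, cauchyPDFReal_one, cauchyPDFReal_one]
  have := Real.pi_pos
  field_simp
  ring

lemma measurable_trueDensity (a p : ℝ) : Measurable (trueDensity a p) := by
  unfold trueDensity
  fun_prop

lemma integrable_trueDensity (a p : ℝ) : Integrable (trueDensity a p) :=
  ((integrable_cauchyPDFReal a).const_mul p).add ((integrable_cauchyPDFReal (-a)).const_mul (1 - p))

lemma integral_trueDensity (a p : ℝ) : ∫ y, trueDensity a p y = 1 := by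
  simp only [trueDensity]
  rw [integral_add ((integrable_cauchyPDFReal a).const_mul p)
    ((integrable_cauchyPDFReal (-a)).const_mul (1 - p)), integral_const_mul, integral_const_mul,
    integral_cauchyPDFReal_eq_one _ one_ne_zero, integral_cauchyPDFReal_eq_one _ one_ne_zero]
  ring

lemma trueDensity_nonneg {a p : ℝ} (h0 : 0 ≤ p) (h1 : p ≤ 1) (y : ℝ) : 0 ≤ trueDensity a p y :=
  add_nonneg (mul_nonneg h0 (cauchyPDF_pos a one_ne_zero y).le)
    (mul_nonneg (sub_nonneg.2 h1) (cauchyPDF_pos (-a) one_ne_zero y).le)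

lemma integrable_trueLaw_iff {a p : ℝ} (h0 : 0 ≤ p) (h1 : p ≤ 1) (f : ℝ → ℝ) :
    Integrable f (trueLaw a p) ↔ Integrable (fun y => trueDensity a p y * f y) := by
  rw [trueLaw, integrable_withDensity_iff (measurable_trueDensity a p).ennreal_ofReal (by simp)]
  simp only [ENNReal.toReal_ofReal (trueDensity_nonneg h0 h1 _), mul_comm]

lemma integral_trueLaw {a p : ℝ} (h0 : 0 ≤ p) (h1 : p ≤ 1) (f : ℝ → ℝ) :
    ∫ y, f y ∂trueLaw a p = ∫ y, trueDensity a p y * f y := by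
  rw [trueLaw, integral_withDensity_eq_integral_toReal_smul
    (measurable_trueDensity a p).ennreal_ofReal (by simp)]
  simp only [ENNReal.toReal_ofReal (trueDensity_nonneg h0 h1 _), smul_eq_mul]

lemma trueLaw_singleton (a p x : ℝ) : trueLaw a p {x} = 0 :=
  withDensity_absolutelyContinuous _ _ (by simp)

/-! ### Minimizers of the risk -/

/-- `log (c + x ^ 2)` is `1`-Lipschitz in `x` for `1 ≤ c`. -/
lemma abs_log_add_sq_sub_le {c : ℝ} (hc : 1 ≤ c) (x y : ℝ) :
    |Real.log (c + x ^ 2) - Real.log (c + y ^ 2)| ≤ |x - y| := by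
  have hd : ∀ x : ℝ, HasDerivAt (fun x => Real.log (c + x ^ 2)) (2 * x / (c + x ^ 2)) x := by
    intro x
    have : HasDerivAt (fun x : ℝ => c + x ^ 2) (2 * x) x := by
      simpa using (hasDerivAt_pow 2 x).const_add c
    exact this.log (by positivity)
  have := Convex.norm_image_sub_le_of_norm_hasDerivWithin_le (C := 1)
    (fun x _ => (hd x).hasDerivWithinAt) (fun x _ => ?_) convex_univ (Set.mem_univ y)
    (Set.mem_univ x)
  · simpa [Real.norm_eq_abs] using this
  · rw [Real.norm_eq_abs, abs_div, abs_of_pos (show 0 < c + x ^ 2 by positivity),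
      div_le_one (by positivity), abs_le]
    constructor <;> nlinarith [sq_nonneg (x - 1), sq_nonneg (x + 1)]

lemma continuous_risk (a p : ℝ) : Continuous (risk a p) := by
  unfold risk
  refine Continuous.add (continuous_const.mul (Continuous.log (by fun_prop) fun x => ?_))
    (continuous_const.mul (Continuous.log (by fun_prop) fun x => ?_)) <;> positivity

lemma tendsto_log_add_sq (c b : ℝ) :
    Tendsto (fun μ : ℝ => Real.log (c + (μ + b) ^ 2)) (cocompact ℝ) atTop := by
  refine Real.tendsto_log_atTop.comp (tendsto_atTop_add_const_left _ _ ?_)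
  have h1 : Tendsto (fun μ : ℝ => μ + b) (cocompact ℝ) (cocompact ℝ) :=
    (Homeomorph.addRight b).isClosedEmbedding.tendsto_cocompact
  have h2 : Tendsto (fun μ : ℝ => ‖μ + b‖ ^ 2) (cocompact ℝ) atTop :=
    (tendsto_pow_atTop two_ne_zero).comp ((tendsto_norm_cocompact_atTop (E := ℝ)).comp h1)
  simpa using h2

lemma tendsto_risk {p : ℝ} (h0 : 0 < p) (h1 : p ≤ 1) (a : ℝ) :
    Tendsto (risk a p) (cocompact ℝ) atTop := by
  refine tendsto_atTop_mono (fun μ => le_add_of_nonneg_right ?_)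
    ((tendsto_log_add_sq 4 (-a)).const_mul_atTop h0)
  exact mul_nonneg (sub_nonneg.2 h1) (Real.log_nonneg (by nlinarith [sq_nonneg (μ + a)]))

lemma exists_risk_le {p : ℝ} (h0 : 0 < p) (h1 : p ≤ 1) (a : ℝ) :
    ∃ g, ∀ μ, risk a p g ≤ risk a p μ :=
  (continuous_risk a p).exists_forall_le (tendsto_risk h0 h1 a)

/-- The first order condition for a minimizer of `risk`. -/
lemma cubic_eq_zero_of_forall_risk_le {a p g : ℝ} (hg : ∀ μ, risk a p g ≤ risk a p μ) :
    g ^ 3 + (2 * p - 1) * a * g ^ 2 + (4 - a ^ 2) * g - (2 * p - 1) * a * (a ^ 2 + 4) = 0 := by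
  have hd (b : ℝ) : HasDerivAt (fun μ : ℝ => Real.log (4 + (μ + b) ^ 2))
      (2 * (g + b) / (4 + (g + b) ^ 2)) g := by
    have : HasDerivAt (fun x : ℝ => 4 + (x + b) ^ 2) (2 * (g + b)) g := by
      simpa using (((hasDerivAt_id g).add_const b).pow 2).const_add 4
    exact this.log (by positivity)
  have h1 : HasDerivAt (risk a p) (p * (2 * (g + -a) / (4 + (g + -a) ^ 2)) +
      (1 - p) * (2 * (g + a) / (4 + (g + a) ^ 2))) g :=
    ((hd (-a)).const_mul p).add ((hd a).const_mul (1 - p))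
  have h2 : IsLocalMin (risk a p) g := Eventually.of_forall hg
  have h3 := h2.hasDerivAt_eq_zero h1
  have e1 : (4 + (g + -a) ^ 2) ≠ 0 := by positivity
  have e2 : (4 + (g + a) ^ 2) ≠ 0 := by positivity
  field_simp at h3
  linear_combination h3 / 2

/-- Reflecting a negative point lowers the risk, because the component at `a` has the larger weight;
zero is excluded because the cubic has a nonzero constant term. -/
lemma pos_of_forall_risk_le {a p g : ℝ} (ha : 2 < a) (hp : 1 / 2 < p)
    (hg : ∀ μ, risk a p g ≤ risk a p μ) : 0 < g := by
  by_contra! hneg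
  rcases hneg.lt_or_eq with hlt | rfl
  · have h1 := hg (-g)
    have h2 : Real.log (4 + (g + a) ^ 2) < Real.log (4 + (g - a) ^ 2) :=
      Real.log_lt_log (by positivity) (by nlinarith)
    simp only [risk, show (-g - a) ^ 2 = (g + a) ^ 2 by ring,
      show (-g + a) ^ 2 = (g - a) ^ 2 by ring] at h1
    nlinarith
  · have := cubic_eq_zero_of_forall_risk_le hg
    have h3 : 0 < (2 * p - 1) * a * (a ^ 2 + 4) := by
      have : 0 < 2 * p - 1 := by linarith
      positivity
    nlinarith

/-- The linear coefficient `4 - a²` is the only one of unfavourable sign. Combining the two cubics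
as `y * ex - x * ey` eliminates it and leaves `x - y` times a positive quantity. -/
lemma eq_of_forall_risk_le {a p x y : ℝ} (ha : 2 < a) (hp : 1 / 2 < p)
    (hx : ∀ μ, risk a p x ≤ risk a p μ) (hy : ∀ μ, risk a p y ≤ risk a p μ) : x = y := by
  have hx0 := pos_of_forall_risk_le ha hp hx
  have hy0 := pos_of_forall_risk_le ha hp hy
  have ex := cubic_eq_zero_of_forall_risk_le hx
  have ey := cubic_eq_zero_of_forall_risk_le hy
  have hq : 0 < 2 * p - 1 := by linarith
  have h1 : (x - y) * (x * y * (x + y) + (2 * p - 1) * a * x * y +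
      (2 * p - 1) * a * (a ^ 2 + 4)) = 0 := by
    linear_combination y * ex - x * ey
  have h2 : 0 < x * y * (x + y) + (2 * p - 1) * a * x * y + (2 * p - 1) * a * (a ^ 2 + 4) := by
    positivity
  rcases mul_eq_zero.1 h1 with h | h
  · linarith
  · exact absurd h h2.ne'

/-- With equal weights the logarithms merge, and completing the square in `μ²` displays the
minimizers `μ² = a² - 4`. -/
lemma risk_half (a μ : ℝ) :
    risk a (1 / 2) μ = 1 / 2 * Real.log ((μ ^ 2 - (a ^ 2 - 4)) ^ 2 + 16 * a ^ 2) := by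
  rw [risk, show (μ ^ 2 - (a ^ 2 - 4)) ^ 2 + 16 * a ^ 2 = (4 + (μ - a) ^ 2) * (4 + (μ + a) ^ 2) by
    ring, Real.log_mul (by positivity) (by positivity)]
  ring

lemma risk_half_le_iff {a : ℝ} (ha : 2 < a) (x y : ℝ) :
    risk a (1 / 2) x ≤ risk a (1 / 2) y ↔
      (x ^ 2 - (a ^ 2 - 4)) ^ 2 ≤ (y ^ 2 - (a ^ 2 - 4)) ^ 2 := by
  have : 0 < a := by linarith
  rw [risk_half, risk_half, mul_le_mul_iff_right₀ (by norm_num),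
    Real.log_le_log_iff (by positivity) (by positivity)]
  simp

/-- The minimizer of `risk` selected in the theorem. -/
noncomputable def limitPoint (p a : ℝ) : ℝ :=
  open Classical in
  if p = 1 / 2 then Real.sqrt (a ^ 2 - 4)
  -- The default `0` is not reached for `1/2 < p ≤ 1`: coercivity provides a minimizer.
  else if hg : ∃ g, ∀ μ, risk a p g ≤ risk a p μ then hg.choose else 0

lemma limitPoint_half (a : ℝ) : limitPoint (1 / 2) a = Real.sqrt (a ^ 2 - 4) := if_pos rfl

lemma sq_limitPoint_half {a : ℝ} (ha : 2 < a) : limitPoint (1 / 2) a ^ 2 = a ^ 2 - 4 := by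
  rw [limitPoint_half, Real.sq_sqrt (by nlinarith)]

lemma risk_limitPoint_le {a p : ℝ} (ha : 2 < a) (hp : 1 / 2 ≤ p) (h1 : p ≤ 1) (μ : ℝ) :
    risk a p (limitPoint p a) ≤ risk a p μ := by
  rcases hp.eq_or_lt with rfl | hp
  · rw [risk_half_le_iff ha, sq_limitPoint_half ha, sub_self, zero_pow two_ne_zero]
    positivity
  · have hex := exists_risk_le (by linarith) h1 a
    rw [limitPoint, if_neg hp.ne', dif_pos hex]
    exact hex.choose_spec μ

lemma limitPoint_nonneg {a p : ℝ} (ha : 2 < a) (hp : 1 / 2 ≤ p) (h1 : p ≤ 1) :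
    0 ≤ limitPoint p a := by
  have := risk_limitPoint_le ha hp h1
  rcases hp.eq_or_lt with rfl | hp
  · rw [limitPoint_half]
    exact Real.sqrt_nonneg _
  · exact (pos_of_forall_risk_le ha hp this).le

lemma eq_limitPoint_of_forall_risk_le {a p g : ℝ} (ha : 2 < a) (hp : 1 / 2 < p) (h1 : p ≤ 1)
    (hg : ∀ μ, risk a p g ≤ risk a p μ) : g = limitPoint p a :=
  eq_of_forall_risk_le ha hp hg (risk_limitPoint_le ha hp.le h1)

lemma eq_or_eq_neg_limitPoint_of_forall_risk_le {a g : ℝ} (ha : 2 < a)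
    (hg : ∀ μ, risk a (1 / 2) g ≤ risk a (1 / 2) μ) :
    g = limitPoint (1 / 2) a ∨ g = -limitPoint (1 / 2) a := by
  have h1 := (risk_half_le_iff ha _ _).1 (hg (limitPoint (1 / 2) a))
  rw [sq_limitPoint_half ha, sub_self] at h1
  have h2 : g ^ 2 = limitPoint (1 / 2) a ^ 2 := by
    rw [sq_limitPoint_half ha]
    nlinarith [pow_eq_zero_iff two_ne_zero |>.1
      (le_antisymm (h1.trans (by norm_num)) (sq_nonneg (g ^ 2 - (a ^ 2 - 4))))]
  exact sq_eq_sq_iff_eq_or_eq_neg.1 h2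

/-- To the right of `a` both logarithms in the risk exceed their values at `a`. -/
lemma limitPoint_le {a p : ℝ} (ha : 2 < a) (hp : 1 / 2 ≤ p) (h1 : p ≤ 1) :
    limitPoint p a ≤ a := by
  by_contra! hlt
  have h2 := risk_limitPoint_le ha hp h1 a
  have h3 : Real.log (4 + (a - a) ^ 2) < Real.log (4 + (limitPoint p a - a) ^ 2) :=
    Real.log_lt_log (by positivity) (by nlinarith)
  have h4 : Real.log (4 + (a + a) ^ 2) ≤ Real.log (4 + (limitPoint p a + a) ^ 2) :=
    Real.log_le_log (by positivity) (by nlinarith)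
  simp only [risk] at h2
  nlinarith

/-! ### Asymptotics of the limit for large `a` -/

lemma risk_self (a p : ℝ) :
    risk a p a = Real.log 4 + (1 - p) * Real.log (1 + a ^ 2) := by
  rw [risk, show 4 + (a + a) ^ 2 = 4 * (1 + a ^ 2) by ring,
    Real.log_mul (by norm_num) (by positivity)]
  norm_num
  ring

/-- Put `u = a - limitPoint p a`. Moving from `a` to the minimizer gains at most `(1 - p) log (1 +
4u/a)` and costs `p log (1 + u²/4)`. As `u ≤ a`, the first logarithm is at most `log 5`; since `1 -
p ≤ p`, minimality forces `u ≤ 4`, and the gain is at most `4u/a ≤ 16/a`. -/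
lemma risk_self_sub_le {a p : ℝ} (ha : 2 < a) (hp : 1 / 2 ≤ p) (h1 : p ≤ 1) :
    risk a p a - risk a p (limitPoint p a) ≤ 16 / a := by
  have ha0 : 0 < a := by linarith
  obtain ⟨u, hu⟩ : ∃ u, u = a - limitPoint p a := ⟨_, rfl⟩
  have hg : limitPoint p a = a - u := by linarith
  have hu0 : 0 ≤ u := by linarith [limitPoint_le ha hp h1]
  have hua : u ≤ a := by linarith [limitPoint_nonneg ha hp h1]
  have hmin := risk_limitPoint_le ha hp h1 a
  have e : risk a p a - risk a p (limitPoint p a) =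
      (1 - p) * Real.log ((4 + (a + a) ^ 2) / (4 + (a - u + a) ^ 2)) -
        p * Real.log (1 + u ^ 2 / 4) := by
    rw [hg, risk, risk, Real.log_div (by positivity) (by positivity),
      show 4 + (a - u - a) ^ 2 = 4 * (1 + u ^ 2 / 4) by ring,
      Real.log_mul (by norm_num) (by positivity)]
    norm_num
    ring
  have hlog1 : Real.log ((4 + (a + a) ^ 2) / (4 + (a - u + a) ^ 2)) ≤ Real.log (1 + 4 * u / a) := by
    refine Real.log_le_log (by positivity) ?_
    rw [div_le_iff₀ (by positivity)]
    have h5 : a ^ 2 ≤ 4 + (a - u + a) ^ 2 := by nlinarith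
    have h6 : 4 * u * a ≤ 4 * u / a * (4 + (a - u + a) ^ 2) := by
      rw [div_mul_eq_mul_div, le_div_iff₀ ha0]
      nlinarith
    nlinarith
  have hlog2 : Real.log (1 + 4 * u / a) ≤ 4 * u / a := by
    have := Real.log_le_sub_one_of_pos (show 0 < 1 + 4 * u / a by positivity)
    linarith
  have hlog3 : Real.log (1 + 4 * u / a) ≤ Real.log 5 := by
    refine Real.log_le_log (by positivity) ?_
    have : 4 * u / a ≤ 4 := by rw [div_le_iff₀ ha0]; linarith
    linarith
  have hlog4 : 0 ≤ Real.log (1 + 4 * u / a) :=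
    Real.log_nonneg (by linarith [show 0 ≤ 4 * u / a by positivity])
  have hlog5 : 0 ≤ Real.log (1 + u ^ 2 / 4) :=
    Real.log_nonneg (by linarith [show 0 ≤ u ^ 2 / 4 by positivity])
  have hu4 : u ≤ 4 := by
    have h7 : Real.log (1 + u ^ 2 / 4) ≤ Real.log 5 := by nlinarith
    have h8 := (Real.log_le_log_iff (by positivity) (by norm_num)).1 h7
    nlinarith
  have h9 : 4 * u / a ≤ 16 / a := by gcongr; linarith
  rw [e]
  nlinarith

lemma tendsto_elpdLimit_sub {p : ℝ} (hp : 1 / 2 ≤ p) (h1 : p ≤ 1) :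
    Tendsto (fun a => elpdLimit a p (limitPoint p a) -
      (-(1 - p) * Real.log (1 + a ^ 2) - Real.log (4 * Real.pi))) atTop (𝓝 0) := by
  have hlim : Tendsto (fun a : ℝ => 16 / a) atTop (𝓝 0) := tendsto_const_nhds.div_atTop tendsto_id
  have e (a : ℝ) : elpdLimit a p (limitPoint p a) -
      (-(1 - p) * Real.log (1 + a ^ 2) - Real.log (4 * Real.pi)) =
      risk a p a - risk a p (limitPoint p a) := by
    rw [elpdLimit_eq, risk_self, Real.log_mul (by norm_num) Real.pi_pos.ne']
    ring
  simp only [e]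
  refine squeeze_zero' ?_ ?_ hlim
  · filter_upwards [eventually_gt_atTop 2] with a ha
    exact sub_nonneg.2 (risk_limitPoint_le ha hp h1 a)
  · filter_upwards [eventually_gt_atTop 2] with a ha
    exact risk_self_sub_le ha hp h1

/-! ### Continuity of the expected log predictive density under concentration -/

/-- A coercive continuous function is bounded away from its minimum off a neighbourhood of the
minimizers. -/
lemma exists_pos_forall_add_le {f : ℝ → ℝ} (hf : Continuous f)
    (hlim : Tendsto f (cocompact ℝ) atTop) {U : Set ℝ} (hU : IsOpen U) {g : ℝ}
    (hg : ∀ μ, f g ≤ f μ) (hmem : ∀ x, (∀ μ, f x ≤ f μ) → x ∈ U) :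
    ∃ ε > 0, ∀ μ ∉ U, f g + ε ≤ f μ := by
  rcases Set.eq_empty_or_nonempty Uᶜ with hemp | ⟨x₀, hx₀⟩
  · exact ⟨1, one_pos, fun μ hμ => absurd (show μ ∈ Uᶜ from hμ) (by simp [hemp])⟩
  · obtain ⟨x, hx, hmin⟩ := hf.continuousOn.exists_isMinOn' hU.isClosed_compl hx₀
      ((hlim.eventually_ge_atTop (f x₀)).filter_mono inf_le_left)
    have hlt : f g < f x := by
      refine lt_of_le_of_ne (hg x) fun heq => hx (hmem x fun μ => heq ▸ hg μ)
    exact ⟨f x - f g, sub_pos.2 hlt, fun μ hμ => by have := hmin hμ; simp at this; linarith⟩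

lemma continuous_cauchyPDFReal_uncurry :
    Continuous (fun q : ℝ × ℝ => cauchyPDFReal q.1 1 q.2) := by
  simp only [cauchyPDFReal_one]
  have := Real.pi_pos
  exact Continuous.inv₀ (by fun_prop) fun q => by positivity

lemma cauchyPDFReal_one_le (m y : ℝ) : cauchyPDFReal m 1 y ≤ Real.pi⁻¹ := by
  rw [cauchyPDFReal_one]
  have := Real.pi_pos
  exact inv_anti₀ this (by nlinarith [sq_nonneg (y - m)])

/-- The Cauchy density at `t`, as a bounded continuous function of the location. -/
noncomputable def cauchyPDFAt (t : ℝ) : BoundedContinuousFunction ℝ ℝ :=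
  BoundedContinuousFunction.ofNormedAddCommGroup (fun m => cauchyPDFReal m 1 t)
    (continuous_cauchyPDFReal_uncurry.comp (by fun_prop : Continuous fun m : ℝ => (m, t))) Real.pi⁻¹
    fun m => by
      rw [Real.norm_eq_abs, abs_of_nonneg (cauchyPDF_pos m one_ne_zero t).le]
      exact cauchyPDFReal_one_le m t

lemma integrable_cauchyPDFReal_location (ν : Measure ℝ) [IsFiniteMeasure ν] (t : ℝ) :
    Integrable (fun m => cauchyPDFReal m 1 t) ν :=
  (cauchyPDFAt t).integrable ν

lemma predictiveDensity_le (ν : Measure ℝ) [IsProbabilityMeasure ν] (t : ℝ) :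
    predictiveDensity ν t ≤ Real.pi⁻¹ := by
  refine (integral_mono (integrable_cauchyPDFReal_location ν t) (integrable_const Real.pi⁻¹)
    fun m => cauchyPDFReal_one_le m t).trans ?_
  simp

lemma measurable_predictiveDensity (ν : Measure ℝ) [IsFiniteMeasure ν] :
    Measurable (predictiveDensity ν) := by
  have : StronglyMeasurable (fun q : ℝ × ℝ => cauchyPDFReal q.2 1 q.1) :=
    (continuous_cauchyPDFReal_uncurry.comp continuous_swap).stronglyMeasurable
  exact this.integral_prod_right.measurable

lemma inv_le_cauchyPDFReal {R m : ℝ} (hm : |m| ≤ R) (t : ℝ) :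
    (2 * Real.pi * (1 + R ^ 2) * (1 + t ^ 2))⁻¹ ≤ cauchyPDFReal m 1 t := by
  have := Real.pi_pos
  rw [cauchyPDFReal_one]
  refine inv_anti₀ (by positivity) ?_
  have h1 : m ^ 2 ≤ R ^ 2 := sq_le_sq' (abs_le.1 hm).1 (abs_le.1 hm).2
  have h2 : 1 + (t - m) ^ 2 ≤ 2 * (1 + R ^ 2) * (1 + t ^ 2) := by
    nlinarith [sq_nonneg (t + m), mul_nonneg (sq_nonneg R) (sq_nonneg t)]
  nlinarith

/-- Half of the mass in a bounded set already gives the predictive density a Cauchy tail. Hence its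
logarithm is dominated by a constant plus `log (1 + t²)`, an integrable majorant that depends on `ν`
only through `R`. -/
lemma inv_le_predictiveDensity {ν : Measure ℝ} [IsProbabilityMeasure ν] {R : ℝ}
    (hR : 1 / 2 ≤ ν.real (Metric.closedBall 0 R)) (t : ℝ) :
    (4 * Real.pi * (1 + R ^ 2) * (1 + t ^ 2))⁻¹ ≤ predictiveDensity ν t := by
  have hpi := Real.pi_pos
  have h1 : ∫ _ in Metric.closedBall (0 : ℝ) R, (2 * Real.pi * (1 + R ^ 2) * (1 + t ^ 2))⁻¹ ∂ν ≤
      ∫ m in Metric.closedBall (0 : ℝ) R, cauchyPDFReal m 1 t ∂ν := by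
    refine setIntegral_mono_on (integrable_const _)
      (integrable_cauchyPDFReal_location ν t).integrableOn measurableSet_closedBall fun m hm => ?_
    exact inv_le_cauchyPDFReal (by simpa using hm) t
  have h2 : ∫ m in Metric.closedBall (0 : ℝ) R, cauchyPDFReal m 1 t ∂ν ≤
      predictiveDensity ν t :=
    setIntegral_le_integral (integrable_cauchyPDFReal_location ν t)
      (ae_of_all _ fun m => (cauchyPDF_pos m one_ne_zero t).le)
  refine le_trans ?_ (h1.trans h2)
  rw [setIntegral_const, smul_eq_mul]
  calc (4 * Real.pi * (1 + R ^ 2) * (1 + t ^ 2))⁻¹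
      = 1 / 2 * (2 * Real.pi * (1 + R ^ 2) * (1 + t ^ 2))⁻¹ := by field_simp; norm_num
    _ ≤ _ := by gcongr

lemma abs_log_predictiveDensity_le {ν : Measure ℝ} [IsProbabilityMeasure ν] {R : ℝ}
    (hR : 1 / 2 ≤ ν.real (Metric.closedBall 0 R)) (t : ℝ) :
    |Real.log (predictiveDensity ν t)| ≤
      Real.log (4 * Real.pi * (1 + R ^ 2)) + Real.log (1 + (t - 0) ^ 2) := by
  have hpi := Real.pi_pos
  have h1 := inv_le_predictiveDensity hR t
  have h0 : 0 < (4 * Real.pi * (1 + R ^ 2) * (1 + t ^ 2))⁻¹ := by positivity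
  have h2 := Real.log_le_log h0 h1
  rw [Real.log_inv, Real.log_mul (by positivity) (by positivity)] at h2
  have h3 : Real.log (predictiveDensity ν t) ≤ 0 :=
    Real.log_nonpos (h0.le.trans h1) ((predictiveDensity_le ν t).trans
      (inv_le_one_of_one_le₀ (by linarith [Real.pi_gt_three])))
  rw [abs_of_nonpos h3, sub_zero]
  linarith

lemma integrable_trueDensity_mul_const_add_log (a p K : ℝ) :
    Integrable (fun t => trueDensity a p t * (K + Real.log (1 + (t - 0) ^ 2))) := by
  simp only [mul_add]
  exact ((integrable_trueDensity a p).mul_const K).add (integrable_trueDensity_mul_log a p 0)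

lemma norm_trueDensity_mul_log_predictiveDensity_le {a p : ℝ} (h0 : 0 ≤ p) (h1 : p ≤ 1)
    {ν : Measure ℝ} [IsProbabilityMeasure ν] {R : ℝ}
    (hR : 1 / 2 ≤ ν.real (Metric.closedBall 0 R)) (t : ℝ) :
    ‖trueDensity a p t * Real.log (predictiveDensity ν t)‖ ≤
      trueDensity a p t *
        (Real.log (4 * Real.pi * (1 + R ^ 2)) + Real.log (1 + (t - 0) ^ 2)) := by
  rw [norm_mul, Real.norm_eq_abs, Real.norm_eq_abs, abs_of_nonneg (trueDensity_nonneg h0 h1 t)]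
  exact mul_le_mul_of_nonneg_left (abs_log_predictiveDensity_le hR t) (trueDensity_nonneg h0 h1 t)

lemma aestronglyMeasurable_elpd_integrand (a p : ℝ) (ν : Measure ℝ) [IsFiniteMeasure ν] :
    AEStronglyMeasurable (fun t => trueDensity a p t * Real.log (predictiveDensity ν t)) :=
  ((measurable_trueDensity a p).mul
    (Real.measurable_log.comp (measurable_predictiveDensity ν))).aestronglyMeasurable

lemma exists_half_le_measureReal_closedBall (ν : Measure ℝ) [IsProbabilityMeasure ν] :
    ∃ R : ℝ, 1 / 2 ≤ ν.real (Metric.closedBall 0 R) := by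
  have h1 : Tendsto (fun n : ℕ => ν.real (Metric.closedBall 0 (n : ℝ))) atTop
      (𝓝 (ν.real (⋃ n : ℕ, Metric.closedBall 0 (n : ℝ)))) := by
    refine (ENNReal.tendsto_toReal (measure_ne_top _ _)).comp (tendsto_measure_iUnion_atTop ?_)
    exact fun m n hmn => Metric.closedBall_subset_closedBall (by exact_mod_cast hmn)
  rw [Metric.iUnion_closedBall_nat, probReal_univ] at h1
  obtain ⟨n, hn⟩ := (h1.eventually_const_le (show (1 : ℝ) / 2 < 1 by norm_num)).exists
  exact ⟨n, hn⟩

/-- The integral defining `elpd` converges absolutely, for every probability measure. -/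
lemma integrable_elpd_integrand {a p : ℝ} (h0 : 0 ≤ p) (h1 : p ≤ 1)
    (ν : Measure ℝ) [IsProbabilityMeasure ν] :
    Integrable (fun t => trueDensity a p t * Real.log (predictiveDensity ν t)) := by
  obtain ⟨R, hR⟩ := exists_half_le_measureReal_closedBall ν
  exact (integrable_trueDensity_mul_const_add_log a p _).mono'
    (aestronglyMeasurable_elpd_integrand a p ν)
    (ae_of_all _ (norm_trueDensity_mul_log_predictiveDensity_le h0 h1 hR))

/-- Probability measures whose mass concentrates at `g` converge weakly to the point mass. -/
lemma tendsto_integral_of_concentrates {ν : ℕ → Measure ℝ} [∀ n, IsProbabilityMeasure (ν n)]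
    {g : ℝ} (hν : ∀ δ > 0, Tendsto (fun n => (ν n).real (Metric.ball g δ)ᶜ) atTop (𝓝 0))
    (f : BoundedContinuousFunction ℝ ℝ) :
    Tendsto (fun n => ∫ μ, f μ ∂ν n) atTop (𝓝 (f g)) := by
  rw [Metric.tendsto_atTop']
  intro ε hε
  obtain ⟨δ, hδ, hball⟩ := Metric.continuousAt_iff.1 (f.continuous.continuousAt (x := g)) (ε / 2)
    (by positivity)
  have hlim : Tendsto (fun n => ε / 2 + 2 * ‖f‖ * (ν n).real (Metric.ball g δ)ᶜ) atTop
      (𝓝 (ε / 2 + 2 * ‖f‖ * 0)) := ((hν δ hδ).const_mul _).const_add _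
  have hev := hlim.eventually_lt_const (show ε / 2 + 2 * ‖f‖ * 0 < ε by linarith)
  obtain ⟨N, hN⟩ := eventually_atTop.1 hev
  refine ⟨N, fun n hn => lt_of_le_of_lt ?_ (hN n hn.le)⟩
  have hc : ∫ _, f g ∂ν n = f g := by simp
  rw [Real.dist_eq, ← hc, ← integral_sub (f.integrable _) (integrable_const _)]
  have hmeas : MeasurableSet (Metric.ball g δ)ᶜ := measurableSet_ball.compl
  have hind : Integrable (fun μ => ε / 2 + (Metric.ball g δ)ᶜ.indicator (fun _ => 2 * ‖f‖) μ) (ν n) :=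
    (integrable_const _).add ((integrable_const _).indicator hmeas)
  calc |∫ μ, (f μ - f g) ∂ν n| ≤ ∫ μ, ‖f μ - f g‖ ∂ν n := by
        rw [← Real.norm_eq_abs]
        exact norm_integral_le_integral_norm _
    _ ≤ ∫ μ, (ε / 2 + (Metric.ball g δ)ᶜ.indicator (fun _ => 2 * ‖f‖) μ) ∂ν n := by
        refine integral_mono ((f.integrable _).sub (integrable_const _)).norm hind fun μ => ?_
        by_cases hμ : μ ∈ Metric.ball g δ
        · simpa [hμ, Real.dist_eq] using (hball hμ).le
        · have h1 := norm_sub_le (f μ) (f g)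
          have h2 := f.norm_coe_le_norm μ
          have h3 := f.norm_coe_le_norm g
          simp only [Set.indicator_of_mem (show μ ∈ (Metric.ball g δ)ᶜ from hμ)]
          linarith
    _ = ε / 2 + 2 * ‖f‖ * (ν n).real (Metric.ball g δ)ᶜ := by
        rw [integral_add (integrable_const _) ((integrable_const _).indicator hmeas),
          integral_indicator_const _ hmeas]
        simp [mul_comm]

/-- `elpd` is continuous along probability measures concentrating at a point. -/
lemma tendsto_elpd_of_concentrates {a p : ℝ} (h0 : 0 ≤ p) (h1 : p ≤ 1)
    {ν : ℕ → Measure ℝ} [∀ n, IsProbabilityMeasure (ν n)]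
    {g : ℝ} (hν : ∀ δ > 0, Tendsto (fun n => (ν n).real (Metric.ball g δ)ᶜ) atTop (𝓝 0)) :
    Tendsto (fun n => elpd a p (ν n)) atTop (𝓝 (elpdLimit a p g)) := by
  have hlimit : elpdLimit a p g = ∫ t, trueDensity a p t * Real.log (cauchyPDFReal g 1 t) := by
    have e (t : ℝ) : trueDensity a p t * Real.log (cauchyPDFReal g 1 t) =
        -(Real.log Real.pi) * trueDensity a p t -
          trueDensity a p t * Real.log (1 + (t - g) ^ 2) := by
      rw [cauchyPDFReal_one, Real.log_inv, Real.log_mul Real.pi_pos.ne' (by positivity)]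
      ring
    simp only [e]
    rw [integral_sub ((integrable_trueDensity a p).const_mul _)
      (integrable_trueDensity_mul_log a p g), integral_const_mul, integral_trueDensity,
      integral_trueDensity_mul_log, elpdLimit_eq, mul_one]
  rw [hlimit]
  refine tendsto_integral_filter_of_dominated_convergence _
    (Eventually.of_forall fun n => aestronglyMeasurable_elpd_integrand a p (ν n)) ?_
    (integrable_trueDensity_mul_const_add_log a p
      (Real.log (4 * Real.pi * (1 + (|g| + 1) ^ 2)))) (ae_of_all _ fun t => ?_)
  · filter_upwards [(hν 1 one_pos).eventually_le_const (show (0 : ℝ) < 1 / 2 by norm_num)]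
      with n hn
    refine ae_of_all _ (norm_trueDensity_mul_log_predictiveDensity_le h0 h1 ?_)
    rw [probReal_compl_eq_one_sub measurableSet_ball] at hn
    refine le_trans (by linarith : 1 / 2 ≤ (ν n).real (Metric.ball g 1)) (measureReal_mono ?_)
    intro x hx
    simp only [Metric.mem_ball, Real.dist_eq, Metric.mem_closedBall, sub_zero] at hx ⊢
    have := abs_add_le (x - g) g
    rw [sub_add_cancel] at this
    linarith
  · refine Tendsto.const_mul _ (Tendsto.log ?_ (cauchyPDF_pos g one_ne_zero t).ne')
    exact tendsto_integral_of_concentrates hν (cauchyPDFAt t)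

/-- Uniform version of `tendsto_elpd_of_concentrates`. -/
lemma exists_pos_abs_elpd_sub_lt {a p : ℝ} (h0 : 0 ≤ p) (h1 : p ≤ 1) (g : ℝ) {ε : ℝ}
    (hε : 0 < ε) :
    ∃ η > 0, ∀ (ν : Measure ℝ) [IsProbabilityMeasure ν], ν.real (Metric.ball g η)ᶜ ≤ η →
      |elpd a p ν - elpdLimit a p g| < ε := by
  -- Counterexamples for `η = 1 / (n + 1)` would form a sequence concentrating at `g`. Uniformity in
  -- `ν` is needed where the centre of concentration varies with the data and with `n`.
  by_contra! hcon
  choose ν hprob hle hge using fun n : ℕ => hcon (1 / ((n : ℝ) + 1)) (by positivity)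
  have hzero := tendsto_one_div_add_atTop_nhds_zero_nat (𝕜 := ℝ)
  have hν : ∀ δ > 0, Tendsto (fun n => (ν n).real (Metric.ball g δ)ᶜ) atTop (𝓝 0) := by
    intro δ hδ
    refine squeeze_zero' (Eventually.of_forall fun n => measureReal_nonneg) ?_ hzero
    filter_upwards [hzero.eventually_le_const hδ] with n hn
    exact (measureReal_mono (Set.compl_subset_compl.2 (Metric.ball_subset_ball hn))).trans (hle n)
  obtain ⟨n, hn⟩ := ((Metric.tendsto_nhds.1
    (tendsto_elpd_of_concentrates (a := a) h0 h1 hν)) ε hε).exists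
  rw [Real.dist_eq] at hn
  exact absurd hn (not_lt.2 (hge n))

/-! ### The posterior and its consistency -/

/-- Negative log likelihood of the location `μ`, up to the constant `n * log π`. -/
noncomputable def negLogLik (y : ℕ → ℝ) (n : ℕ) (μ : ℝ) : ℝ :=
  ∑ i ∈ Finset.range n, Real.log (1 + (y i - μ) ^ 2)

lemma likelihood_eq (y : ℕ → ℝ) (n : ℕ) (μ : ℝ) :
    likelihood y n μ =
      ENNReal.ofReal (Real.exp (-(n * Real.log Real.pi + negLogLik y n μ))) := by
  have hpi := Real.pi_pos
  have e (i : ℕ) : cauchyPDF μ 1 (y i) =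
      ENNReal.ofReal (Real.exp (-(Real.log Real.pi + Real.log (1 + (y i - μ) ^ 2)))) := by
    rw [cauchyPDF_def, cauchyPDFReal_one, Real.exp_neg, Real.exp_add, Real.exp_log hpi,
      Real.exp_log (by positivity)]
  simp only [likelihood, e]
  rw [← ENNReal.ofReal_prod_of_nonneg fun i _ => (Real.exp_pos _).le, ← Real.exp_sum,
    Finset.sum_neg_distrib, Finset.sum_add_distrib, negLogLik]
  simp

lemma measurable_negLogLik_uncurry (n : ℕ) :
    Measurable (fun q : (ℕ → ℝ) × ℝ => negLogLik q.1 n q.2) := by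
  unfold negLogLik
  fun_prop

lemma measurable_likelihood_uncurry (n : ℕ) :
    Measurable (fun q : (ℕ → ℝ) × ℝ => likelihood q.1 n q.2) := by
  simp only [likelihood_eq]
  have := measurable_negLogLik_uncurry n
  fun_prop

lemma measurable_likelihood (y : ℕ → ℝ) (n : ℕ) : Measurable (likelihood y n) := by
  have : likelihood y n = fun μ =>
      ENNReal.ofReal (Real.exp (-(n * Real.log Real.pi + negLogLik y n μ))) :=
    funext (likelihood_eq y n)
  rw [this]
  unfold negLogLik
  fun_prop

lemma negLogLik_nonneg (y : ℕ → ℝ) (n : ℕ) (μ : ℝ) : 0 ≤ negLogLik y n μ :=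
  Finset.sum_nonneg fun i _ => Real.log_nonneg (by nlinarith [sq_nonneg (y i - μ)])

lemma likelihood_le_one (y : ℕ → ℝ) (n : ℕ) (μ : ℝ) : likelihood y n μ ≤ 1 := by
  rw [likelihood_eq, ENNReal.ofReal_le_one, Real.exp_le_one_iff, neg_nonpos]
  have := Real.log_nonneg (by linarith [Real.pi_gt_three] : 1 ≤ Real.pi)
  have := negLogLik_nonneg y n μ
  positivity

lemma lintegral_likelihood_ne_zero (prior : Measure ℝ) [IsProbabilityMeasure prior]
    (y : ℕ → ℝ) (n : ℕ) : ∫⁻ μ, likelihood y n μ ∂prior ≠ 0 := by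
  rw [Ne, lintegral_eq_zero_iff (measurable_likelihood y n)]
  intro h
  have h2 : ∀ᵐ _ ∂prior, False := by
    filter_upwards [h] with μ hμ
    rw [likelihood_eq] at hμ
    simp only [Pi.zero_apply, ENNReal.ofReal_eq_zero] at hμ
    exact absurd hμ (not_le.2 (Real.exp_pos _))
  simp at h2
  exact IsProbabilityMeasure.ne_zero prior h2

lemma lintegral_likelihood_ne_top (prior : Measure ℝ) [IsProbabilityMeasure prior]
    (y : ℕ → ℝ) (n : ℕ) : ∫⁻ μ, likelihood y n μ ∂prior ≠ ⊤ := by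
  refine ne_top_of_le_ne_top ENNReal.one_ne_top
    ((lintegral_mono fun μ => likelihood_le_one y n μ).trans ?_)
  simp

instance isProbabilityMeasure_posterior (prior : Measure ℝ) [IsProbabilityMeasure prior]
    (y : ℕ → ℝ) (n : ℕ) : IsProbabilityMeasure (posterior prior y n) := by
  constructor
  rw [posterior, Measure.smul_apply, withDensity_apply _ MeasurableSet.univ, setLIntegral_univ,
    smul_eq_mul]
  exact ENNReal.inv_mul_cancel (lintegral_likelihood_ne_zero prior y n)
    (lintegral_likelihood_ne_top prior y n)

lemma posterior_apply (prior : Measure ℝ) (y : ℕ → ℝ) (n : ℕ) {s : Set ℝ}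
    (hs : MeasurableSet s) :
    posterior prior y n s =
      (∫⁻ μ, likelihood y n μ ∂prior)⁻¹ * ∫⁻ μ in s, likelihood y n μ ∂prior := by
  rw [posterior, Measure.smul_apply, withDensity_apply _ hs, smul_eq_mul]

/-- Posterior mass of a set, bounded by comparing the likelihood on it with the likelihood on
another set. -/
lemma posterior_le_of_negLogLik {prior : Measure ℝ} [IsProbabilityMeasure prior] {y : ℕ → ℝ}
    {n : ℕ} {s t : Set ℝ} (hs : MeasurableSet s) {α β : ℝ}
    (hα : ∀ μ ∈ s, α ≤ negLogLik y n μ) (hβ : ∀ μ ∈ t, negLogLik y n μ ≤ β)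
    (h0 : prior t ≠ 0) :
    posterior prior y n s ≤ ENNReal.ofReal (Real.exp (β - α)) * (prior t)⁻¹ := by
  have h1 : ∫⁻ μ in s, likelihood y n μ ∂prior ≤
      ENNReal.ofReal (Real.exp (-(n * Real.log Real.pi + α))) := by
    calc ∫⁻ μ in s, likelihood y n μ ∂prior
        ≤ ∫⁻ _ in s, ENNReal.ofReal (Real.exp (-(n * Real.log Real.pi + α))) ∂prior := by
          refine setLIntegral_mono measurable_const fun μ hμ => ?_
          rw [likelihood_eq]
          gcongr
          exact hα μ hμ
      _ ≤ _ := by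
          rw [setLIntegral_const]
          exact mul_le_of_le_one_right' prob_le_one
  have h2 : ENNReal.ofReal (Real.exp (-(n * Real.log Real.pi + β))) * prior t ≤
      ∫⁻ μ, likelihood y n μ ∂prior := by
    rw [← setLIntegral_const]
    refine (setLIntegral_mono (measurable_likelihood y n) fun μ hμ => ?_).trans
      (setLIntegral_le_lintegral t _)
    rw [likelihood_eq]
    gcongr
    exact hβ μ hμ
  rw [posterior_apply prior y n hs]
  calc _ ≤ (ENNReal.ofReal (Real.exp (-(n * Real.log Real.pi + β))) * prior t)⁻¹ *
        ENNReal.ofReal (Real.exp (-(n * Real.log Real.pi + α))) := by gcongr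
    _ = _ := by
        rw [ENNReal.mul_inv (Or.inr (measure_ne_top _ _)) (Or.inr h0),
          ← ENNReal.ofReal_inv_of_pos (Real.exp_pos _), mul_right_comm,
          ← ENNReal.ofReal_mul (by positivity), ← Real.exp_neg, ← Real.exp_add]
        ring_nf

lemma abs_negLogLik_sub_le (y : ℕ → ℝ) (n : ℕ) (μ ν : ℝ) :
    |negLogLik y n μ - negLogLik y n ν| ≤ n * |μ - ν| := by
  rw [negLogLik, negLogLik, ← Finset.sum_sub_distrib]
  refine (Finset.abs_sum_le_sum_abs _ _).trans ?_
  refine (Finset.sum_le_card_nsmul _ _ |μ - ν| fun i _ => ?_).trans (by simp)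
  refine (abs_log_add_sq_sub_le le_rfl _ _).trans ?_
  rw [sub_sub_sub_cancel_left, abs_sub_comm]

/-- One observation cannot be close both to `μ` and to `0` when `μ` is large. Summed over the data,
this makes the average negative log likelihood coercive in `μ`, uniformly in `n`, once its value at
`0` is bounded. -/
lemma log_le_log_add_log (y μ : ℝ) :
    Real.log (1 + μ ^ 2 / 2) ≤ Real.log (1 + (y - μ) ^ 2) + Real.log (1 + (y - 0) ^ 2) := by
  rw [← Real.log_mul (by positivity) (by positivity)]
  refine Real.log_le_log (by positivity) ?_
  nlinarith [sq_nonneg (2 * y - μ), mul_nonneg (sq_nonneg (y - μ)) (sq_nonneg y)]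

lemma mul_log_sub_le_negLogLik (y : ℕ → ℝ) (n : ℕ) (μ : ℝ) :
    n * Real.log (1 + μ ^ 2 / 2) - negLogLik y n 0 ≤ negLogLik y n μ := by
  rw [sub_le_iff_le_add, negLogLik, negLogLik, ← Finset.sum_add_distrib]
  refine le_trans (by simp) (Finset.card_nsmul_le_sum (Finset.range n) _
    (Real.log (1 + μ ^ 2 / 2)) fun i _ => log_le_log_add_log (y i) μ)

/-- Data along which the law of large numbers holds for the log likelihood. -/
def IsTypical (a p : ℝ) (y : ℕ → ℝ) : Prop :=
  ∀ q : ℚ, Tendsto (fun n : ℕ => negLogLik y n q / n) atTop (𝓝 (risk a p q))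

/-- Rational locations keep the typical event a countable intersection; the averages are 1-Lipschitz
in `μ` and the risk is continuous, so the limit extends to every real location. -/
lemma IsTypical.tendsto {a p : ℝ} {y : ℕ → ℝ} (hy : IsTypical a p y) (μ : ℝ) :
    Tendsto (fun n : ℕ => negLogLik y n μ / n) atTop (𝓝 (risk a p μ)) := by
  rw [Metric.tendsto_nhds]
  intro ε hε
  obtain ⟨δ, hδ, hcont⟩ := Metric.continuousAt_iff.1 ((continuous_risk a p).continuousAt (x := μ))
    (ε / 3) (by positivity)
  obtain ⟨q, hq1, hq2⟩ := exists_rat_btwn (show μ < μ + min δ (ε / 3) by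
    linarith [lt_min hδ (show 0 < ε / 3 by positivity)])
  have hqμ : |(q : ℝ) - μ| < min δ (ε / 3) := by rw [abs_lt]; constructor <;> linarith
  have h1 : |risk a p q - risk a p μ| < ε / 3 := by
    simpa [Real.dist_eq] using hcont (x := (q : ℝ))
      (by rw [Real.dist_eq]; exact hqμ.trans_le (min_le_left _ _))
  filter_upwards [Metric.tendsto_nhds.1 (hy q) (ε / 3) (by positivity), eventually_gt_atTop 0]
    with n hn hn0
  rw [Real.dist_eq] at hn ⊢
  have hn' : (0 : ℝ) < n := by exact_mod_cast hn0
  have h2 : |negLogLik y n μ / n - negLogLik y n q / n| ≤ |(q : ℝ) - μ| := by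
    rw [← sub_div, abs_div, abs_of_pos hn', div_le_iff₀ hn', mul_comm, abs_sub_comm (q : ℝ)]
    exact abs_negLogLik_sub_le y n μ q
  have h3 := hqμ.trans_le (min_le_right _ _)
  calc |negLogLik y n μ / n - risk a p μ|
      ≤ |negLogLik y n μ / n - negLogLik y n q / n| + |negLogLik y n q / n - risk a p μ| :=
        abs_sub_le _ _ _
    _ ≤ |negLogLik y n μ / n - negLogLik y n q / n| +
        (|negLogLik y n q / n - risk a p q| + |risk a p q - risk a p μ|) := by
        gcongr; exact abs_sub_le _ _ _
    _ < ε := by linarith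

lemma IsTypical.eventually_forall_le {a p : ℝ} (h0 : 0 < p) (h1 : p ≤ 1) {y : ℕ → ℝ}
    (hy : IsTypical a p y) {U : Set ℝ} (hU : IsOpen U) {g : ℝ}
    (hg : ∀ μ, risk a p g ≤ risk a p μ) (hmem : ∀ x, (∀ μ, risk a p x ≤ risk a p μ) → x ∈ U) :
    ∃ ε > 0, ∀ᶠ n : ℕ in atTop, ∀ μ ∈ Uᶜ, n * (risk a p g + ε) ≤ negLogLik y n μ := by
  obtain ⟨ε, hε, hgap⟩ := exists_pos_forall_add_le (continuous_risk a p) (tendsto_risk h0 h1 a) hU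
    hg hmem
  refine ⟨ε / 2, by positivity, ?_⟩
  -- The summand `log 2` rescales `2 + μ²` to `1 + μ²/2`, and `risk a p 0 + 1` will absorb the
  -- average negative log likelihood at `0`.
  have hcoer := (tendsto_log_add_sq 2 0).eventually_ge_atTop
    (Real.log 2 + (risk a p 0 + 1 + risk a p g + ε))
  obtain ⟨K, hK, hKsub⟩ := mem_cocompact.1 hcoer
  have hout : ∀ᶠ n : ℕ in atTop, ∀ μ ∈ Kᶜ, n * (risk a p g + ε / 2) ≤ negLogLik y n μ := by
    filter_upwards [(hy.tendsto 0).eventually_le_const (show risk a p 0 < risk a p 0 + 1 by simp),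
      eventually_gt_atTop 0] with n hn hn0 μ hμ
    have hn' : (0 : ℝ) < n := by exact_mod_cast hn0
    rw [div_le_iff₀ hn'] at hn
    have h2 := hKsub hμ
    simp only [Set.mem_ofPred_eq, add_zero] at h2
    rw [show 2 + μ ^ 2 = 2 * (1 + μ ^ 2 / 2) by ring,
      Real.log_mul (by norm_num) (by positivity), add_le_add_iff_left] at h2
    have h3 := mul_log_sub_le_negLogLik y n μ
    have h4 := mul_le_mul_of_nonneg_left h2 hn'.le
    nlinarith
  -- Of the gap `ε`, a quarter is lost to the law of large numbers at `x` and a quarter to the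
  -- Lipschitz bound on the ball.
  have hloc (x : ℝ) (hx : x ∈ Uᶜ) : ∀ᶠ n : ℕ in atTop, ∀ μ ∈ Metric.ball x (ε / 4),
      n * (risk a p g + ε / 2) ≤ negLogLik y n μ := by
    filter_upwards [(hy.tendsto x).eventually_const_le
      (show risk a p x - ε / 4 < risk a p x by linarith), eventually_gt_atTop 0] with n hn hn0 μ hμ
    have hn' : (0 : ℝ) < n := by exact_mod_cast hn0
    rw [le_div_iff₀ hn'] at hn
    have h2 := (abs_le.1 (abs_negLogLik_sub_le y n μ x)).1
    have h3 : n * |μ - x| ≤ n * (ε / 4) := by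
      gcongr; exact (Metric.mem_ball.1 hμ).le
    have h4 := mul_le_mul_of_nonneg_left (hgap x hx) hn'.le
    nlinarith
  have hKU : IsCompact (K ∩ Uᶜ) := hK.inter_right hU.isClosed_compl
  obtain ⟨F, hF, hcover⟩ := hKU.elim_nhds_subcover (fun x => Metric.ball x (ε / 4))
    fun x _ => Metric.ball_mem_nhds x (by positivity)
  have hin : ∀ᶠ n : ℕ in atTop, ∀ x ∈ F, ∀ μ ∈ Metric.ball x (ε / 4),
      n * (risk a p g + ε / 2) ≤ negLogLik y n μ :=
    (eventually_all_finset F).2 fun x hx => hloc x (hF x hx).2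
  filter_upwards [hout, hin] with n hn1 hn2 μ hμ
  by_cases hμK : μ ∈ K
  · obtain ⟨x, hx, hxμ⟩ := Set.mem_iUnion₂.1 (hcover ⟨hμK, hμ⟩)
    exact hn2 x hx μ hxμ
  · exact hn1 μ hμK

/-- Posterior consistency: for typical data, the mass off a neighbourhood of the minimizers of the
risk vanishes. -/
lemma IsTypical.tendsto_posterior_compl {a p : ℝ} (h0 : 0 < p) (h1 : p ≤ 1) {y : ℕ → ℝ}
    (hy : IsTypical a p y) {U : Set ℝ} (hU : IsOpen U) {g : ℝ}
    (hg : ∀ μ, risk a p g ≤ risk a p μ) (hmem : ∀ x, (∀ μ, risk a p x ≤ risk a p μ) → x ∈ U)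
    (prior : Measure ℝ) [IsProbabilityMeasure prior] [prior.IsOpenPosMeasure] :
    Tendsto (fun n => (posterior prior y n).real Uᶜ) atTop (𝓝 0) := by
  obtain ⟨ε, hε, hfar⟩ := hy.eventually_forall_le h0 h1 hU hg hmem
  have hball : prior (Metric.ball g (ε / 4)) ≠ 0 :=
    (Metric.measure_ball_pos prior g (by positivity)).ne'
  -- Near `g` the average exceeds the minimum by at most `ε/2`, off `U` by at least `ε`; the ratio
  -- of likelihoods is thus at most `exp (-n ε/2)`, while full support gives the ball positive prior
  -- mass.
  have hnear : ∀ᶠ n : ℕ in atTop, ∀ μ ∈ Metric.ball g (ε / 4),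
      negLogLik y n μ ≤ n * (risk a p g + ε / 2) := by
    filter_upwards [(hy.tendsto g).eventually_le_const
      (show risk a p g < risk a p g + ε / 4 by linarith), eventually_gt_atTop 0] with n hn hn0 μ hμ
    have hn' : (0 : ℝ) < n := by exact_mod_cast hn0
    rw [div_le_iff₀ hn'] at hn
    have h2 := (abs_le.1 (abs_negLogLik_sub_le y n μ g)).2
    have h3 : n * |μ - g| ≤ n * (ε / 4) := by
      gcongr; exact (Metric.mem_ball.1 hμ).le
    nlinarith
  have hexp : Tendsto (fun n : ℕ => Real.exp (-(n * (ε / 2)))) atTop (𝓝 0) :=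
    Real.tendsto_exp_neg_atTop_nhds_zero.comp
      (tendsto_natCast_atTop_atTop.atTop_mul_const (by positivity))
  have hlim : Tendsto (fun n : ℕ => ENNReal.ofReal (Real.exp (-(n * (ε / 2)))) *
      (prior (Metric.ball g (ε / 4)))⁻¹) atTop (𝓝 0) := by
    have := ENNReal.Tendsto.mul_const (b := (prior (Metric.ball g (ε / 4)))⁻¹)
      (ENNReal.tendsto_ofReal hexp) (Or.inr (ENNReal.inv_ne_top.2 hball))
    simpa using this
  have hpost : Tendsto (fun n => posterior prior y n Uᶜ) atTop (𝓝 0) := by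
    refine tendsto_of_tendsto_of_tendsto_of_le_of_le' tendsto_const_nhds hlim
      (Eventually.of_forall fun n => zero_le) ?_
    filter_upwards [hfar, hnear] with n hn1 hn2
    have := posterior_le_of_negLogLik (prior := prior) hU.isClosed_compl.measurableSet
      hn1 hn2 hball
    rwa [show n * (risk a p g + ε / 2) - n * (risk a p g + ε) = -(n * (ε / 2)) by ring] at this
  exact (ENNReal.tendsto_toReal ENNReal.zero_ne_top).comp hpost

variable {Ω : Type*} [MeasurableSpace Ω] {P : Measure Ω}

lemma integrable_log_trueLaw {a p : ℝ} (h0 : 0 ≤ p) (h1 : p ≤ 1) (μ : ℝ) :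
    Integrable (fun y => Real.log (1 + (y - μ) ^ 2)) (trueLaw a p) :=
  (integrable_trueLaw_iff h0 h1 _).2 (integrable_trueDensity_mul_log a p μ)

lemma ae_isTypical [IsProbabilityMeasure P] {a p : ℝ} (h0 : 0 ≤ p) (h1 : p ≤ 1) {Y : ℕ → Ω → ℝ}
    (hindep : iIndepFun Y P) (hlaw : ∀ i, HasLaw (Y i) (trueLaw a p) P) :
    ∀ᵐ ω ∂P, IsTypical a p (fun i => Y i ω) := by
  refine ae_all_iff.2 fun q => ?_
  have hm : Measurable fun y : ℝ => Real.log (1 + (y - q) ^ 2) := by fun_prop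
  have hint : Integrable (fun ω => Real.log (1 + (Y 0 ω - q) ^ 2)) P := by
    have h2 := integrable_log_trueLaw (a := a) h0 h1 q
    rw [← (hlaw 0).map_eq] at h2
    exact h2.comp_aemeasurable (hlaw 0).aemeasurable
  have hmean : ∫ ω, Real.log (1 + (Y 0 ω - q) ^ 2) ∂P = risk a p q := by
    rw [← integral_trueDensity_mul_log, ← integral_trueLaw h0 h1, ← (hlaw 0).map_eq,
      integral_map (hlaw 0).aemeasurable hm.aestronglyMeasurable]
  have hslln := strong_law_ae_real (fun i ω => Real.log (1 + (Y i ω - q) ^ 2)) hint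
    (fun i j hij => (hindep.indepFun hij).comp hm hm)
    (fun i => IdentDistrib.comp ⟨(hlaw i).aemeasurable, (hlaw 0).aemeasurable,
      (hlaw i).map_eq.trans (hlaw 0).map_eq.symm⟩ hm)
  rw [hmean] at hslln
  exact hslln

/-! ### Lower and upper size of centered iid sums -/

section RandomSums

variable {Ω : Type*} [MeasurableSpace Ω] {P : Measure Ω} [IsProbabilityMeasure P] {X : ℕ → Ω → ℝ}

/-- Centered iid sums are unlikely to be small on the scale `√n`. -/
lemma exists_pos_eventually_measure_abs_le (hindep : iIndepFun X P)
    (hident : ∀ i, IdentDistrib (X i) (X 0) P P) (hL : MemLp (X 0) 2 P) (hmean : P[X 0] = 0)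
    (hvar : Var[X 0; P] ≠ 0) {ρ : ENNReal} (hρ : 0 < ρ) :
    ∃ κ > 0, ∀ᶠ n : ℕ in atTop,
      P {ω | |(√(n : ℝ))⁻¹ * ∑ k ∈ Finset.range n, X k ω| ≤ κ} ≤ ρ := by
  set v := Var[X 0; P].toNNReal with hv
  have hv0 : v ≠ 0 := by
    rw [hv, Ne, Real.toNNReal_eq_zero, not_le]
    exact lt_of_le_of_ne (variance_nonneg _ _) hvar.symm
  -- The limiting Gaussian has no atom at `0`, so a short closed interval has small mass; the
  -- portmanteau inequality for closed sets carries this to large `n`.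
  have := nullSingletonClass_gaussianReal (μ := 0) hv0
  have hsmall : ∀ᶠ κ in 𝓝[>] (0 : ℝ), gaussianReal 0 v (Set.Icc (0 - κ) (0 + κ)) < ρ :=
    ((tendsto_measure_Icc (gaussianReal 0 v) 0).eventually_lt_const hρ).filter_mono inf_le_left
  obtain ⟨κ, hκ, hκ0⟩ := (hsmall.and self_mem_nhdsWithin).exists
  refine ⟨κ, hκ0, ?_⟩
  have hclt := tendstoInDistribution_inv_sqrt_mul_sum_sub (Y := id) (P' := gaussianReal 0 v)
    ⟨aemeasurable_id, Measure.map_id⟩ hL hindep hident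
  have hlim := ProbabilityMeasure.limsup_measure_closed_le_of_tendsto hclt.tendsto
    (F := Set.Icc (0 - κ) (0 + κ)) isClosed_Icc
  have hlt := lt_of_le_of_lt hlim (by simpa using hκ)
  filter_upwards [eventually_lt_of_limsup_lt hlt] with n hn
  refine le_trans (le_of_eq ?_) hn.le
  simp only [ProbabilityMeasure.coe_mk]
  rw [Measure.map_apply_of_aemeasurable (hclt.forall_aemeasurable n) measurableSet_Icc, hmean]
  congr 1
  ext ω
  simp only [Set.mem_preimage, Set.mem_Icc, mul_zero, sub_zero, zero_sub, zero_add,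
    Set.mem_ofPred_eq, abs_le]

/-- The mean size of a sum of `n` bounded centered independent variables is at most of order
`√n`. -/
lemma lintegral_enorm_sum_le (hindep : iIndepFun X P) (hmeas : ∀ i, AEMeasurable (X i) P) {C : ℝ}
    (hC : 0 < C) (hbound : ∀ i ω, |X i ω| ≤ C) (hmean : ∀ i, P[X i] = 0) (n : ℕ) :
    ∫⁻ ω, ‖∑ k ∈ Finset.range n, X k ω‖ₑ ∂P ≤ ENNReal.ofReal (C * √(n : ℝ)) := by
  rcases n.eq_zero_or_pos with rfl | hn
  · simp
  have hn' : (0 : ℝ) < √(n : ℝ) := Real.sqrt_pos.2 (by exact_mod_cast hn)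
  have hL (i : ℕ) : MemLp (X i) 2 P :=
    MemLp.of_bound (hmeas i).aestronglyMeasurable C (ae_of_all _ (hbound i))
  have hS : MemLp (fun ω => ∑ k ∈ Finset.range n, X k ω) 2 P :=
    memLp_finsetSum _ fun i _ => hL i
  have hSint := hS.integrable one_le_two
  have hSsq := hS.integrable_sq
  have hSmean : ∫ ω, ∑ k ∈ Finset.range n, X k ω ∂P = 0 := by
    rw [integral_finsetSum _ fun i _ => (hL i).integrable one_le_two]
    exact Finset.sum_eq_zero fun i _ => hmean i
  have hvar (i : ℕ) : Var[X i; P] ≤ C ^ 2 := by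
    refine (variance_le_expectation_sq (hmeas i).aestronglyMeasurable).trans ?_
    refine (integral_mono (g := fun _ => C ^ 2) (hL i).integrable_sq (integrable_const _)
      fun ω => ?_).trans (by simp)
    exact sq_le_sq' (abs_le.1 (hbound i ω)).1 (abs_le.1 (hbound i ω)).2
  have hsq : ∫ ω, (∑ k ∈ Finset.range n, X k ω) ^ 2 ∂P ≤ n * C ^ 2 := by
    have h1 := IndepFun.variance_sum (s := Finset.range n) (fun i _ => hL i)
      fun i _ j _ hij => hindep.indepFun hij
    have h2 : (∑ k ∈ Finset.range n, X k) = fun ω => ∑ k ∈ Finset.range n, X k ω := by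
      ext ω
      simp
    rw [h2, variance_of_integral_eq_zero hS.aestronglyMeasurable.aemeasurable hSmean] at h1
    rw [h1]
    exact (Finset.sum_le_card_nsmul _ _ _ fun i _ => hvar i).trans (by simp)
  rw [← ofReal_integral_norm_eq_lintegral_enorm hSint]
  refine ENNReal.ofReal_le_ofReal ?_
  -- With `b = C √n`, the inequality `s ≤ s²/(2b) + b/2` reduces the first moment to the second,
  -- which is at most `b²`.
  calc ∫ ω, ‖∑ k ∈ Finset.range n, X k ω‖ ∂P
      ≤ ∫ ω, ((2 * (C * √n))⁻¹ * (∑ k ∈ Finset.range n, X k ω) ^ 2 + C * √n / 2) ∂P := by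
        refine integral_mono hSint.norm ((hSsq.const_mul _).add (integrable_const _)) fun ω => ?_
        obtain ⟨b, hb⟩ : ∃ b, b = C * √(n : ℝ) := ⟨_, rfl⟩
        have hb0 : 0 < b := hb ▸ mul_pos hC hn'
        simp only [Real.norm_eq_abs, ← hb]
        rw [← sq_abs (∑ k ∈ Finset.range n, X k ω)]
        generalize |∑ k ∈ Finset.range n, X k ω| = s
        rw [← sub_nonneg]
        have : (2 * b)⁻¹ * s ^ 2 + b / 2 - s = (2 * b)⁻¹ * (s - b) ^ 2 := by
          field_simp
          ring
        rw [this]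
        positivity
    _ = (2 * (C * √n))⁻¹ * ∫ ω, (∑ k ∈ Finset.range n, X k ω) ^ 2 ∂P + C * √n / 2 := by
        rw [integral_add (hSsq.const_mul _) (integrable_const _), integral_const_mul]
        simp
    _ ≤ (2 * (C * √n))⁻¹ * (n * C ^ 2) + C * √n / 2 := by gcongr
    _ = C * √n := by
        have h3 : (n : ℝ) = √n ^ 2 := (Real.sq_sqrt (Nat.cast_nonneg n)).symm
        generalize √(n : ℝ) = r at *
        rw [h3]
        field_simp
        norm_num

end RandomSums

/-! ### Competition between the two mirror modes -/

/-- Log likelihood ratio of the locations `μ` and `-μ` for one observation. -/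
noncomputable def logRatio (μ y : ℝ) : ℝ :=
  Real.log (1 + (y + μ) ^ 2) - Real.log (1 + (y - μ) ^ 2)

/-- Derivative of `logRatio` in the location. -/
noncomputable def logRatioDeriv (μ y : ℝ) : ℝ :=
  2 * (y + μ) / (1 + (y + μ) ^ 2) + 2 * (y - μ) / (1 + (y - μ) ^ 2)

lemma negLogLik_neg_sub (y : ℕ → ℝ) (n : ℕ) (μ : ℝ) :
    negLogLik y n (-μ) - negLogLik y n μ = ∑ i ∈ Finset.range n, logRatio μ (y i) := by
  simp only [negLogLik, logRatio, ← Finset.sum_sub_distrib, sub_neg_eq_add]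

lemma hasDerivAt_logRatio (μ y : ℝ) :
    HasDerivAt (fun μ => logRatio μ y) (logRatioDeriv μ y) μ := by
  have h1 : HasDerivAt (fun μ : ℝ => 1 + (y + μ) ^ 2) (2 * (y + μ)) μ := by
    simpa using (((hasDerivAt_id μ).const_add y).pow 2).const_add 1
  have h2 : HasDerivAt (fun μ : ℝ => 1 + (y - μ) ^ 2) (-(2 * (y - μ))) μ := by
    simpa using (((hasDerivAt_id μ).const_sub y).pow 2).const_add 1
  have := (h1.log (by positivity)).sub (h2.log (by positivity))
  exact this.congr_deriv (by rw [logRatioDeriv]; ring)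

lemma continuous_logRatioDeriv_uncurry :
    Continuous (fun q : ℝ × ℝ => logRatioDeriv q.1 q.2) := by
  unfold logRatioDeriv
  refine Continuous.add (Continuous.div (by fun_prop) (by fun_prop) fun q => ?_)
    (Continuous.div (by fun_prop) (by fun_prop) fun q => ?_) <;> positivity

lemma abs_logRatioDeriv_le (μ y : ℝ) : |logRatioDeriv μ y| ≤ 2 := by
  have h (x : ℝ) : |2 * x / (1 + x ^ 2)| ≤ 1 := by
    rw [abs_div, abs_of_pos (show 0 < 1 + x ^ 2 by positivity), div_le_one (by positivity), abs_le]
    constructor <;> nlinarith [sq_nonneg (x - 1), sq_nonneg (x + 1)]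
  have := abs_add_le (2 * (y + μ) / (1 + (y + μ) ^ 2)) (2 * (y - μ) / (1 + (y - μ) ^ 2))
  rw [logRatioDeriv]
  linarith [h (y + μ), h (y - μ)]

lemma logRatioDeriv_neg (μ y : ℝ) : logRatioDeriv μ (-y) = -logRatioDeriv μ y := by
  rw [logRatioDeriv, logRatioDeriv, show (-y + μ) = -(y - μ) by ring,
    show (-y - μ) = -(y + μ) by ring, neg_sq, neg_sq]
  ring

lemma logRatio_neg (μ y : ℝ) : logRatio μ (-y) = -logRatio μ y := by
  rw [logRatio, logRatio, show (-y + μ) = -(y - μ) by ring,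
    show (-y - μ) = -(y + μ) by ring, neg_sq, neg_sq]
  ring

lemma measurable_logRatio (μ : ℝ) : Measurable (logRatio μ) := by
  unfold logRatio
  fun_prop

lemma abs_logRatio_le (μ y : ℝ) : |logRatio μ y| ≤ |2 * μ| := by
  refine (abs_log_add_sq_sub_le le_rfl _ _).trans (le_of_eq ?_)
  congr 1
  ring

/-- The arguments of the two logarithms differ by `4 μ y`. This is what makes the log likelihood
ratio nondegenerate. -/
lemma eq_zero_of_logRatio_eq_zero {μ y : ℝ} (hμ : μ ≠ 0) (h : logRatio μ y = 0) : y = 0 := by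
  have h1 := Real.log_injOn_pos (show 0 < 1 + (y + μ) ^ 2 by positivity)
    (show 0 < 1 + (y - μ) ^ 2 by positivity) (sub_eq_zero.1 h)
  have h2 : 4 * μ * y = 0 := by linear_combination h1
  simpa [hμ] using h2

lemma integral_trueLaw_half_of_odd {a : ℝ} {f : ℝ → ℝ} (hf : ∀ y, f (-y) = -f y) :
    ∫ y, f y ∂trueLaw a (1 / 2) = 0 := by
  rw [integral_trueLaw (by norm_num) (by norm_num)]
  have h1 := integral_neg_eq_self (fun y => trueDensity a (1 / 2) y * f y) volume
  have e (y : ℝ) : trueDensity a (1 / 2) (-y) * f (-y) = -(trueDensity a (1 / 2) y * f y) := by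
    rw [hf, trueDensity, trueDensity]
    simp only [cauchyPDFReal_one]
    rw [show -y - a = -(y - -a) by ring, show -y - -a = -(y - a) by ring, neg_sq, neg_sq]
    ring
  simp only [e, integral_neg] at h1
  linarith

/-- If the likelihood ratio of `μ` and `-μ` is large on a set, then its mirror image has small
posterior mass, for a symmetric prior. -/
lemma posterior_neg_le {prior : Measure ℝ} [IsProbabilityMeasure prior]
    (hsymm : prior.map (fun μ => -μ) = prior) {y : ℕ → ℝ} {n : ℕ} {s : Set ℝ}
    (hs : MeasurableSet s) {K : ℝ} (hK : ∀ μ ∈ s, K + negLogLik y n μ ≤ negLogLik y n (-μ)) :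
    (posterior prior y n).real {μ | -μ ∈ s} ≤ Real.exp (-K) := by
  have hneg : MeasurableSet {μ : ℝ | -μ ∈ s} := measurable_neg hs
  refine ENNReal.toReal_le_of_le_ofReal (Real.exp_pos _).le ?_
  -- Symmetry of the prior lets the mirror image be integrated over `s` itself, where the reflected
  -- likelihood is at most `exp (-K)` times the likelihood.
  have h1 : ∫⁻ μ in {μ | -μ ∈ s}, likelihood y n μ ∂prior =
      ∫⁻ μ in s, likelihood y n (-μ) ∂prior := by
    conv_lhs => rw [← hsymm]
    rw [setLIntegral_map hneg (measurable_likelihood y n) measurable_neg]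
    simp
  have h2 : ∫⁻ μ in s, likelihood y n (-μ) ∂prior ≤
      ENNReal.ofReal (Real.exp (-K)) * ∫⁻ μ, likelihood y n μ ∂prior := by
    rw [← lintegral_const_mul _ (measurable_likelihood y n)]
    refine (setLIntegral_mono ((measurable_likelihood y n).const_mul _) fun μ hμ => ?_).trans
      (setLIntegral_le_lintegral s _)
    rw [likelihood_eq, likelihood_eq, ← ENNReal.ofReal_mul (Real.exp_pos _).le, ← Real.exp_add]
    gcongr
    linarith [hK μ hμ]
  rw [posterior_apply prior y n hneg, h1]
  calc _ ≤ (∫⁻ μ, likelihood y n μ ∂prior)⁻¹ *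
        (ENNReal.ofReal (Real.exp (-K)) * ∫⁻ μ, likelihood y n μ ∂prior) := by gcongr
    _ = _ := by
        rw [mul_left_comm, ENNReal.inv_mul_cancel (lintegral_likelihood_ne_zero prior y n)
          (lintegral_likelihood_ne_top prior y n), mul_one]

/-- Oscillation of the log likelihood ratio over a ball, bounded by the integral of its
derivative. -/
lemma ofReal_abs_sum_logRatio_sub_le (y : ℕ → ℝ) (n : ℕ) {g δ μ : ℝ}
    (hμ : μ ∈ Metric.ball g δ) :
    ENNReal.ofReal |∑ i ∈ Finset.range n, logRatio μ (y i) -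
        ∑ i ∈ Finset.range n, logRatio g (y i)| ≤
      ∫⁻ s in Metric.ball g δ, ‖∑ i ∈ Finset.range n, logRatioDeriv s (y i)‖ₑ := by
  have hcont : Continuous fun s => ∑ i ∈ Finset.range n, logRatioDeriv s (y i) :=
    continuous_finsetSum _ fun i _ =>
      continuous_logRatioDeriv_uncurry.comp (by fun_prop : Continuous fun s : ℝ => (s, y i))
  have hftc := intervalIntegral.integral_eq_sub_of_hasDerivAt
    (f := fun s => ∑ i ∈ Finset.range n, logRatio s (y i)) (a := g) (b := μ)
    (fun s _ => HasDerivAt.fun_sum fun i _ => hasDerivAt_logRatio s (y i))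
    (hcont.intervalIntegrable g μ)
  have hsub : Set.uIoc g μ ⊆ Metric.ball g δ :=
    Set.uIoc_subset_uIcc.trans ((convex_ball g δ).ordConnected.uIcc_subset
      (Metric.mem_ball_self (Metric.nonempty_ball.1 ⟨μ, hμ⟩)) hμ)
  rw [← hftc, ← Real.norm_eq_abs, intervalIntegral.norm_integral_eq_norm_integral_uIoc,
    ofReal_norm]
  exact (enorm_integral_le_lintegral_enorm _).trans (lintegral_mono_set hsub)

lemma aestronglyMeasurable_posterior {Ω : Type*} [MeasurableSpace Ω] {P : Measure Ω} {a p : ℝ} {Y : ℕ → Ω → ℝ}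
    (hlaw : ∀ i, HasLaw (Y i) (trueLaw a p) P) (prior : Measure ℝ) [IsProbabilityMeasure prior]
    {s : Set ℝ} (hs : MeasurableSet s) (n : ℕ) :
    AEStronglyMeasurable (fun ω => (posterior prior (fun i => Y i ω) n).real s) P := by
  have h1 : Measurable fun y : ℕ → ℝ => posterior prior y n s := by
    simp only [posterior_apply prior _ n hs]
    exact (measurable_likelihood_uncurry n).lintegral_prod_right'.inv.mul
      (measurable_likelihood_uncurry n).lintegral_prod_right'
  exact (h1.ennreal_toReal.comp_aemeasurable
    (aemeasurable_pi_lambda _ fun i => (hlaw i).aemeasurable)).aestronglyMeasurable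

section Symmetric

variable {Ω : Type*} [MeasurableSpace Ω] {P : Measure Ω} [IsProbabilityMeasure P]

/-- Bounding the oscillation by an integral of the derivative avoids a supremum, so Tonelli and
Markov suffice. The derivative is odd in the observation and bounded by 2, so its sum has mean size
at most `2 √n`; the ball has length `2δ`. -/
lemma measure_oscillation_le {a : ℝ} {Y : ℕ → Ω → ℝ} (hindep : iIndepFun Y P)
    (hlaw : ∀ i, HasLaw (Y i) (trueLaw a (1 / 2)) P) (g : ℝ) {δ κ : ℝ} (hκ : 0 < κ) {n : ℕ}
    (hn : 0 < n) :
    P {ω | ENNReal.ofReal (κ * √(n : ℝ)) ≤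
      ∫⁻ s in Metric.ball g δ, ‖∑ i ∈ Finset.range n, logRatioDeriv s (Y i ω)‖ₑ} ≤
      ENNReal.ofReal (4 * δ / κ) := by
  have hn' : (0 : ℝ) < √(n : ℝ) := Real.sqrt_pos.2 (by exact_mod_cast hn)
  have hmeas : AEMeasurable (fun q : Ω × ℝ =>
      ‖∑ i ∈ Finset.range n, logRatioDeriv q.2 (Y i q.1)‖ₑ)
      (P.prod (volume.restrict (Metric.ball g δ))) := by
    refine (Finset.aemeasurable_fun_sum _ fun i _ => ?_).enorm
    exact continuous_logRatioDeriv_uncurry.measurable.comp_aemeasurable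
      (measurable_snd.aemeasurable.prodMk (hlaw i).aemeasurable.comp_fst)
  have hmean (s : ℝ) (n : ℕ) : ∫⁻ ω, ‖∑ i ∈ Finset.range n, logRatioDeriv s (Y i ω)‖ₑ ∂P ≤
      ENNReal.ofReal (2 * √(n : ℝ)) := by
    have hm : Measurable (logRatioDeriv s) :=
      continuous_logRatioDeriv_uncurry.measurable.comp measurable_prodMk_left
    refine lintegral_enorm_sum_le (X := fun i ω => logRatioDeriv s (Y i ω))
      (hindep.comp _ fun _ => hm) (fun i => hm.comp_aemeasurable (hlaw i).aemeasurable) two_pos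
      (fun i ω => abs_logRatioDeriv_le s _) (fun i => ?_) n
    rw [← integral_map (hlaw i).aemeasurable hm.aestronglyMeasurable, (hlaw i).map_eq]
    exact integral_trueLaw_half_of_odd (logRatioDeriv_neg s)
  refine (meas_ge_le_lintegral_div hmeas.lintegral_prod_right' (by simpa using by positivity)
    ENNReal.ofReal_ne_top).trans ?_
  have hbound : ∫⁻ ω, (∫⁻ s in Metric.ball g δ,
      ‖∑ i ∈ Finset.range n, logRatioDeriv s (Y i ω)‖ₑ) ∂P ≤
      ENNReal.ofReal (2 * √(n : ℝ)) * ENNReal.ofReal (2 * δ) := by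
    rw [lintegral_lintegral_swap hmeas]
    refine (lintegral_mono fun s => hmean s n).trans ?_
    simp
  refine (ENNReal.div_le_div_right hbound _).trans (le_of_eq ?_)
  rw [← ENNReal.ofReal_mul (by positivity), ← ENNReal.ofReal_div_of_pos (by positivity)]
  congr 1
  field_simp
  ring

/-- Oddness centers the summands. Zero variance would force the observation to vanish almost surely,
which a law without atoms excludes. -/
lemma exists_pos_eventually_measure_sum_logRatio_le {a : ℝ} {Y : ℕ → Ω → ℝ}
    (hindep : iIndepFun Y P) (hlaw : ∀ i, HasLaw (Y i) (trueLaw a (1 / 2)) P) {g : ℝ}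
    (hg : g ≠ 0) {ρ : ENNReal} (hρ : 0 < ρ) :
    ∃ κ > 0, ∀ᶠ n : ℕ in atTop,
      P {ω | |(√(n : ℝ))⁻¹ * ∑ k ∈ Finset.range n, logRatio g (Y k ω)| ≤ κ} ≤ ρ := by
  have hm := measurable_logRatio g
  have hid (i : ℕ) : IdentDistrib (Y i) (Y 0) P P :=
    ⟨(hlaw i).aemeasurable, (hlaw 0).aemeasurable, (hlaw i).map_eq.trans (hlaw 0).map_eq.symm⟩
  have hL : MemLp (fun ω => logRatio g (Y 0 ω)) 2 P :=
    MemLp.of_bound (hm.comp_aemeasurable (hlaw 0).aemeasurable).aestronglyMeasurable |2 * g|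
      (ae_of_all _ fun ω => abs_logRatio_le g _)
  have hmean : ∫ ω, logRatio g (Y 0 ω) ∂P = 0 := by
    rw [← integral_map (hlaw 0).aemeasurable hm.aestronglyMeasurable, (hlaw 0).map_eq]
    exact integral_trueLaw_half_of_odd (logRatio_neg g)
  refine exists_pos_eventually_measure_abs_le (X := fun i ω => logRatio g (Y i ω))
    (hindep.comp _ fun _ => hm) (fun i => (hid i).comp hm) hL hmean (fun hvar => ?_) hρ
  have h1 := ae_eq_integral_of_variance_eq_zero hL hvar
  have h2 : ∀ᵐ y ∂trueLaw a (1 / 2), y = 0 := by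
    rw [← (hlaw 0).map_eq, ae_map_iff (p := fun y => y = 0) (hlaw 0).aemeasurable
      (measurableSet_singleton 0)]
    filter_upwards [h1] with ω hω
    exact eq_zero_of_logRatio_eq_zero hg (hω.trans hmean)
  have h3 : ∀ᵐ y ∂trueLaw a (1 / 2), False := by
    have h4 : ∀ᵐ y ∂trueLaw a (1 / 2), y ≠ 0 := by
      rw [ae_iff]
      simpa using trueLaw_singleton a (1 / 2) 0
    filter_upwards [h2, h4] with y hy hy'
    exact hy' hy
  have := (hlaw 0).isProbabilityMeasure_iff.1 inferInstance
  exact IsProbabilityMeasure.ne_zero _ (ae_eq_bot.1 (eventually_false_iff_eq_bot.1 h3))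

end Symmetric

/-! ### Convergence of the posterior and of its elpd -/

section Convergence

variable {Ω : Type*} [MeasurableSpace Ω] {P : Measure Ω} [IsProbabilityMeasure P]

lemma IsTypical.tendsto_posterior_ball_compl {a p : ℝ} (ha : 2 < a) (hp : 1 / 2 < p) (h1 : p ≤ 1)
    {y : ℕ → ℝ} (hy : IsTypical a p y) (prior : Measure ℝ) [IsProbabilityMeasure prior]
    [prior.IsOpenPosMeasure] {δ : ℝ} (hδ : 0 < δ) :
    Tendsto (fun n => (posterior prior y n).real (Metric.ball (limitPoint p a) δ)ᶜ) atTop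
      (𝓝 0) := by
  refine hy.tendsto_posterior_compl (by linarith) h1 Metric.isOpen_ball
    (risk_limitPoint_le ha hp.le h1) (fun x hx => ?_) prior
  rw [eq_limitPoint_of_forall_risk_le ha hp h1 hx]
  exact Metric.mem_ball_self hδ

lemma elpdLimit_half_neg (a g : ℝ) : elpdLimit a (1 / 2) (-g) = elpdLimit a (1 / 2) g := by
  rw [elpdLimit_eq, elpdLimit_eq, risk_half, risk_half, neg_sq]

/-- For a symmetric prior, the posterior selects one of the two modes with high probability. -/
lemma exists_pos_eventually_measure_no_mode_le {a : ℝ} {Y : ℕ → Ω → ℝ} (hindep : iIndepFun Y P)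
    (hlaw : ∀ i, HasLaw (Y i) (trueLaw a (1 / 2)) P) {g : ℝ} (hg : g ≠ 0)
    {prior : Measure ℝ} [IsProbabilityMeasure prior] (hsymm : prior.map (fun μ => -μ) = prior)
    {η : ℝ} (hη : 0 < η) {ρ : ENNReal} (hρ : 0 < ρ) :
    ∃ δ > 0, δ ≤ η ∧ ∀ᶠ n : ℕ in atTop,
      P {ω | η < (posterior prior (fun i => Y i ω) n).real (Metric.ball g δ) ∧
        η < (posterior prior (fun i => Y i ω) n).real (Metric.ball (-g) δ)} ≤ ρ := by
  have hρ2 : 0 < ρ / 2 := ENNReal.half_pos hρ.ne'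
  obtain ⟨κ, hκ, hclt⟩ := exists_pos_eventually_measure_sum_logRatio_le hindep hlaw hg hρ2
  -- Here `δ` is chosen after `κ`, so that the ratio varies by less than half of its value at `g`
  -- over the ball, outside an event of probability at most `ρ / 2`.
  have hsmall : ∀ᶠ δ in 𝓝[>] (0 : ℝ), ENNReal.ofReal (4 * δ / (κ / 2)) < ρ / 2 := by
    have h1 : Tendsto (fun δ : ℝ => ENNReal.ofReal (4 * δ / (κ / 2))) (𝓝 0)
        (𝓝 (ENNReal.ofReal (4 * 0 / (κ / 2)))) := by
      refine ENNReal.tendsto_ofReal (Continuous.tendsto ?_ 0)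
      fun_prop
    exact (h1.eventually_lt_const (by simpa using hρ2)).filter_mono inf_le_left
  obtain ⟨δ, ⟨hδ, hδη⟩, hδ0⟩ :=
    ((hsmall.and ((eventually_le_nhds hη).filter_mono inf_le_left)).and
      self_mem_nhdsWithin).exists
  refine ⟨δ, hδ0, hδη, ?_⟩
  obtain ⟨K, hK⟩ : ∃ K : ℝ, Real.exp (-K) ≤ η :=
    ⟨-Real.log η, by rw [neg_neg, Real.exp_log hη]⟩
  have hsqrt : Tendsto (fun n : ℕ => κ / 2 * √(n : ℝ)) atTop atTop :=
    (Real.tendsto_sqrt_atTop.comp tendsto_natCast_atTop_atTop).const_mul_atTop (by positivity)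
  filter_upwards [hclt, hsqrt.eventually_ge_atTop K, eventually_gt_atTop 0] with n hn1 hn2 hn3
  have hn' : (0 : ℝ) < √(n : ℝ) := Real.sqrt_pos.2 (by exact_mod_cast hn3)
  refine (measure_mono (t := {ω | |(√(n : ℝ))⁻¹ * ∑ k ∈ Finset.range n, logRatio g (Y k ω)| ≤ κ} ∪
    {ω | ENNReal.ofReal (κ / 2 * √(n : ℝ)) ≤ ∫⁻ s in Metric.ball g δ,
      ‖∑ i ∈ Finset.range n, logRatioDeriv s (Y i ω)‖ₑ}) ?_).trans
    ((measure_union_le _ _).trans ?_)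
  · rintro ω ⟨hω1, hω2⟩
    by_contra hcon
    simp only [Set.mem_union, Set.mem_ofPred_eq, not_or, not_le] at hcon
    obtain ⟨hc1, hc2⟩ := hcon
    rw [abs_mul, abs_of_pos (inv_pos.2 hn'), inv_mul_eq_div, lt_div_iff₀ hn'] at hc1
    have hosc (μ : ℝ) (hμ : μ ∈ Metric.ball g δ) :
        |∑ i ∈ Finset.range n, logRatio μ (Y i ω) - ∑ i ∈ Finset.range n, logRatio g (Y i ω)| <
          κ / 2 * √(n : ℝ) := by
      have := (ofReal_abs_sum_logRatio_sub_le (fun i => Y i ω) n hμ).trans_lt hc2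
      exact (ENNReal.ofReal_lt_ofReal_iff (by positivity)).1 this
    have hsets : {μ : ℝ | -μ ∈ Metric.ball g δ} = Metric.ball (-g) δ := by
      ext μ
      simp only [Set.mem_ofPred_eq, Metric.mem_ball, Real.dist_eq]
      rw [← abs_neg, show -(-μ - g) = μ - -g by ring]
    have hsets' : {μ : ℝ | -μ ∈ Metric.ball (-g) δ} = Metric.ball g δ := by
      ext μ
      simp only [Set.mem_ofPred_eq, Metric.mem_ball, Real.dist_eq]
      rw [← abs_neg, show -(-μ - -g) = μ - g by ring]
    -- The sign of the sum at `g` decides the winner: throughout the winning ball the log ratio in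
    -- its favour is at least `κ/2 √n ≥ K`, so its mirror image keeps mass at most `exp (-K) ≤ η`.
    rcases lt_abs.1 hc1 with hpos | hneg
    · have := posterior_neg_le (y := fun i => Y i ω) (n := n) (K := K) hsymm
        (measurableSet_ball (x := g) (ε := δ)) fun μ hμ => by
          have h1 := negLogLik_neg_sub (fun i => Y i ω) n μ
          have h2 := (abs_lt.1 (hosc μ hμ)).1
          linarith
      rw [hsets] at this
      linarith
    · have := posterior_neg_le (y := fun i => Y i ω) (n := n) (K := K) hsymm
        (measurableSet_ball (x := -g) (ε := δ)) fun μ hμ => by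
          have hμ' : -μ ∈ Metric.ball g δ := by
            rw [← hsets] at hμ
            exact hμ
          have h1 := negLogLik_neg_sub (fun i => Y i ω) n (-μ)
          have h2 := (abs_lt.1 (hosc (-μ) hμ')).2
          rw [neg_neg] at h1
          linarith
      rw [hsets'] at this
      linarith
  · exact (add_le_add hn1 ((measure_oscillation_le hindep hlaw g (by positivity) hn3).trans
      hδ.le)).trans (ENNReal.add_halves ρ).le

/-- Convergence of the expected log predictive density in the balanced case. -/
lemma tendstoInMeasure_elpd_half {a : ℝ} (ha : 2 < a) {Y : ℕ → Ω → ℝ} (hindep : iIndepFun Y P)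
    (hlaw : ∀ i, HasLaw (Y i) (trueLaw a (1 / 2)) P)
    (prior : Measure ℝ) [IsProbabilityMeasure prior] [prior.IsOpenPosMeasure]
    (hsymm : prior.map (fun μ => -μ) = prior) :
    TendstoInMeasure P (fun n ω => elpd a (1 / 2) (posterior prior (fun i => Y i ω) n)) atTop
      (fun _ => elpdLimit a (1 / 2) (limitPoint (1 / 2) a)) := by
  set g := limitPoint (1 / 2) a with hgdef
  have hg : g ≠ 0 := by
    intro h0
    have := sq_limitPoint_half ha
    rw [← hgdef, h0] at this
    nlinarith
  rw [tendstoInMeasure_iff_dist]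
  intro ε hε
  obtain ⟨η₁, hη₁, hclose₁⟩ := exists_pos_abs_elpd_sub_lt (a := a) (p := 1 / 2) (by norm_num)
    (by norm_num) g hε
  obtain ⟨η₂, hη₂, hclose₂⟩ := exists_pos_abs_elpd_sub_lt (a := a) (p := 1 / 2) (by norm_num)
    (by norm_num) (-g) hε
  rw [elpdLimit_half_neg] at hclose₂
  -- The factor 2 leaves `η` for the losing ball and `η` for the complement of both balls.
  obtain ⟨η, hη, hle₁, hle₂⟩ : ∃ η > 0, 2 * η ≤ η₁ ∧ 2 * η ≤ η₂ :=
    ⟨min η₁ η₂ / 2, by positivity, by linarith [min_le_left η₁ η₂],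
      by linarith [min_le_right η₁ η₂]⟩
  rw [ENNReal.tendsto_nhds_zero]
  intro ρ hρ
  have hρ2 : 0 < ρ / 2 := ENNReal.half_pos hρ.ne'
  obtain ⟨δ, hδ, hδη, hmode⟩ := exists_pos_eventually_measure_no_mode_le hindep hlaw hg hsymm hη hρ2
  have hU : IsOpen (Metric.ball g δ ∪ Metric.ball (-g) δ) :=
    Metric.isOpen_ball.union Metric.isOpen_ball
  have hcons : TendstoInMeasure P (fun n ω => (posterior prior (fun i => Y i ω) n).real
      (Metric.ball g δ ∪ Metric.ball (-g) δ)ᶜ) atTop (fun _ => (0 : ℝ)) := by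
    refine tendstoInMeasure_of_tendsto_ae
      (aestronglyMeasurable_posterior hlaw prior hU.measurableSet.compl) ?_
    filter_upwards [ae_isTypical (by norm_num) (by norm_num) hindep hlaw] with ω hω
    refine hω.tendsto_posterior_compl (by norm_num) (by norm_num) hU
      (risk_limitPoint_le ha le_rfl (by norm_num)) (fun x hx => ?_) prior
    rcases eq_or_eq_neg_limitPoint_of_forall_risk_le ha hx with rfl | rfl
    · exact Or.inl (Metric.mem_ball_self hδ)
    · exact Or.inr (Metric.mem_ball_self hδ)
  have hfar := ENNReal.tendsto_nhds_zero.1 (tendstoInMeasure_iff_dist.1 hcons η hη) (ρ / 2) hρ2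
  filter_upwards [hmode, hfar] with n hn1 hn2
  refine (measure_mono ?_).trans ((measure_union_le _ _).trans
    ((add_le_add hn1 hn2).trans (ENNReal.add_halves ρ).le))
  intro ω hω
  by_contra hcon
  simp only [Set.mem_union, Set.mem_ofPred_eq, not_or, not_and_or, not_lt, not_le] at hcon hω
  obtain ⟨hc1, hc2⟩ := hcon
  rw [Real.dist_eq, sub_zero, abs_of_nonneg measureReal_nonneg] at hc2
  set ν := posterior prior (fun i => Y i ω) n with hν
  rw [Real.dist_eq] at hω
  refine absurd hω (not_le.2 ?_)
  -- Here `b` is the losing mode and `c` the winning one; `δ ≤ η` places the small ball at `c`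
  -- inside the ball of radius `η'`.
  have hcover (b c : ℝ) (hbc : (Metric.ball b δ ∪ Metric.ball c δ)ᶜ =
      (Metric.ball g δ ∪ Metric.ball (-g) δ)ᶜ) (hb : ν.real (Metric.ball b δ) ≤ η) {η' : ℝ}
      (hη' : 2 * η ≤ η') : ν.real (Metric.ball c η')ᶜ ≤ η' := by
    have hsub : (Metric.ball c η')ᶜ ⊆ (Metric.ball g δ ∪ Metric.ball (-g) δ)ᶜ ∪
        Metric.ball b δ := by
      rw [← hbc]
      intro x hx
      by_cases hxb : x ∈ Metric.ball b δ
      · exact Or.inr hxb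
      · refine Or.inl fun hx' => hx'.elim hxb fun hxc => hx ?_
        exact Metric.ball_subset_ball (by linarith) hxc
    have := (measureReal_mono (μ := ν) hsub).trans (measureReal_union_le _ _)
    linarith
  rcases hc1 with hc1 | hc1
  · exact hclose₂ ν (hcover g (-g) rfl hc1 hle₂)
  · exact hclose₁ ν (hcover (-g) g (by rw [Set.union_comm]) hc1 hle₁)

end Convergence

end CauchyMixture

theorem corollary4 :
    ∃ γ : ℝ → ℝ → ℝ,
      -- the limit point `γ(p₀, a)` in the two cases
      (∀ a p₀ : ℝ, 2 < a → 1 / 2 < p₀ → p₀ ≤ 1 →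
        ∀ μ : ℝ, μ ≠ γ p₀ a → CauchyMixture.h a p₀ μ < CauchyMixture.h a p₀ (γ p₀ a)) ∧
      (∀ a : ℝ, 2 < a → γ (1 / 2) a = Real.sqrt (a ^ 2 - 4)) ∧
      -- the posterior and its elpd are well defined, for all data
      (∀ a p₀ : ℝ, 2 < a → 1 / 2 ≤ p₀ → p₀ ≤ 1 →
        ∀ (prior : Measure ℝ) [IsProbabilityMeasure prior] [prior.IsOpenPosMeasure]
          (y : ℕ → ℝ) (n : ℕ),
          IsProbabilityMeasure (CauchyMixture.posterior prior y n) ∧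
          Integrable (fun t => CauchyMixture.trueDensity a p₀ t *
            Real.log (CauchyMixture.predictiveDensity
              (CauchyMixture.posterior prior y n) t))) ∧
      -- convergence of the posterior and of its elpd
      (∀ {Ω : Type*} [MeasurableSpace Ω] (P : Measure Ω) [IsProbabilityMeasure P]
        (a p₀ : ℝ) (prior : Measure ℝ) [IsProbabilityMeasure prior] [prior.IsOpenPosMeasure]
        (Y : ℕ → Ω → ℝ), 2 < a → p₀ ≤ 1 →
        iIndepFun Y P → (∀ i, HasLaw (Y i) (CauchyMixture.trueLaw a p₀) P) →
        -- `p₀ > 1/2`, arbitrary prior with full support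
        (1 / 2 < p₀ →
          ∀ᵐ ω ∂P,
            (∀ f : BoundedContinuousFunction ℝ ℝ,
              Tendsto (fun n => ∫ μ, f μ ∂(CauchyMixture.posterior prior (fun i => Y i ω) n))
                atTop (𝓝 (f (γ p₀ a)))) ∧
            Tendsto
              (fun n => CauchyMixture.elpd a p₀
                (CauchyMixture.posterior prior (fun i => Y i ω) n))
              atTop (𝓝 (CauchyMixture.elpdLimit a p₀ (γ p₀ a)))) ∧
        -- `p₀ = 1/2`, symmetric prior with full support
        (p₀ = 1 / 2 → prior.map (fun μ => -μ) = prior →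
          TendstoInMeasure P
            (fun n ω => CauchyMixture.elpd a p₀
              (CauchyMixture.posterior prior (fun i => Y i ω) n))
            atTop (fun _ => CauchyMixture.elpdLimit a p₀ (γ p₀ a)))) ∧
      -- approximation of the limit for large `a`
      (∀ p₀ : ℝ, 1 / 2 ≤ p₀ → p₀ ≤ 1 →
        Tendsto
          (fun a => CauchyMixture.elpdLimit a p₀ (γ p₀ a)
            - (-(1 - p₀) * Real.log (1 + a ^ 2) - Real.log (4 * Real.pi)))
          atTop (𝓝 0)) := by
  open CauchyMixture in
  refine ⟨limitPoint, ?_, fun a _ => limitPoint_half a, ?_, ?_,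
    fun p hp h1 => tendsto_elpdLimit_sub hp h1⟩
  · intro a p ha hp h1 μ hμ
    rw [h_eq, h_eq, neg_lt_neg_iff, mul_lt_mul_iff_right₀ Real.pi_pos]
    -- A point whose risk does not exceed that of the limit point is itself a global minimizer,
    -- hence equal to it.
    by_contra! hle
    refine hμ (eq_limitPoint_of_forall_risk_le ha hp h1 fun ν => ?_)
    exact hle.trans (risk_limitPoint_le ha hp.le h1 ν)
  · intro a p ha hp h1 prior _ _ y n
    exact ⟨inferInstance, integrable_elpd_integrand (by linarith) h1 _⟩
  · intro Ω _ P _ a p prior _ _ Y ha h1 hindep hlaw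
    refine ⟨fun hp => ?_, ?_⟩
    · filter_upwards [ae_isTypical (by linarith) h1 hindep hlaw] with ω hω
      have hconc := fun δ hδ => hω.tendsto_posterior_ball_compl ha hp h1 prior (δ := δ) hδ
      exact ⟨tendsto_integral_of_concentrates hconc,
        tendsto_elpd_of_concentrates (by linarith) h1 hconc⟩
    · rintro rfl hsymm
      exact tendstoInMeasure_elpd_half ha hindep hlaw prior hsymm
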